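/- Let $\mathbb T=\mathbb R/2\pi\mathbb Z$ with Lebesgue measure $dx$ (total mass $2\pi$), let $\|u\|_{L^2}^2=\int_{\mathbb T}|u|^2\,dx$ for $u\in L^2(\mathbb T)$, and let $\hat u(n)=\frac1{2\pi}\int_{\mathbb T}e^{-inx}u(x)\,dx$ for $n\in\mathbb Z$. For $t\in\mathbb R$ let $T_t:L^2(\mathbb T)\to L^2(\mathbb T)$ be the solution operator of the linear Schrödinger equation, $\widehat{T_tu}(n)=e^{-in^2t}\hat u(n)$. For $B>0$ and $u\in L^2(\mathbb T)$ put $$W_B(u)=\int_0^B\int_{\mathbb T}|T_tu(x)|^4\,dx\,dt,\qquad J_{B,1}=\sup\{W_B(u):u\in L^2(\mathbb T),\ \|u\|_{L^2}=1\}.$$ A maximizing sequence for $J_{B,1}$ is a sequence $\{u_j\}$ in $L^2(\mathbb T)$ with $\|u_j\|_{L^2}=1$ for all $j$ and $W_B(u_j)\to J_{B,1}$; a maximizer is a $u_0\in L^2(\mathbb T)$ with $\|u_0\|_{L^2}=1$ and $W_B(u_0)=J_{B,1}$. Theorem 1. Let $B>0$. Then $J_{B,1}$ is finite, and: (i) If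 $J_{B,1}>B/\pi$, then for every maximizing sequence $\{u_j\}$ for $J_{B,1}$ there are a subsequence $\{u_{j_k}\}$ and integers $\theta_k$ such that $\{e^{i\theta_kx}u_{j_k}(x)\}$ converges strongly in $L^2(\mathbb T)$ to a maximizer for $J_{B,1}$. In particular, a maximizer for $J_{B,1}$ exists. (ii) $J_{B,1}\ge B/\pi$. (iii) If $J_{B,1}=B/\pi$, then there is a maximizing sequence $\{u_j\}$ for $J_{B,1}$, vanishing in Fourier space in the sense that $\lim_{j\to\infty}\sup_{m\in\mathbb Z}\sum_{|n-m|\le r}|\widehat{u_j}(n)|^2=0$ for every $r\in\mathbb N$, such that for no subsequence $\{u_{j_k}\}$ and no sequence of real numbers $\{\theta_k\}$ (in particular, no sequence of integers) does $\{e^{i\theta_kx}u_{j_k}(x)\}$, with $x$ taken in $[0,2\pi)$, converge strongly in $L^2(\mathbb T)$. -/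

import Mathlib

open MeasureTheory Filter Topology
open scoped ENNReal Real

namespace TorusStrichartz

noncomputable section

/-- The torus `ℝ / 2πℤ`. -/
abbrev Torus : Type := AddCircle (2 * π)

instance fact_two_pi_pos : Fact (0 < 2 * π) := ⟨Real.two_pi_pos⟩

/-- `L²(𝕋)` for Lebesgue measure `dx` of total mass `2π`, so that `‖u‖² = ∫_𝕋 |u|² dx`. -/
abbrev L2T : Type := Lp ℂ 2 (volume : Measure Torus)

/-- The Fourier coefficient `û(n) = (2π)⁻¹ ∫_𝕋 e^{-inx} u(x) dx`. (Mathlib's `fourierCoeff`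
integrates against the normalized measure `dx / 2π`.) -/
def coeff (u : L2T) (n : ℤ) : ℂ := fourierCoeff (u : Torus → ℂ) n

/-- `u`, regarded as an element of `L²` of the normalized measure `dx / 2π`. -/
def toHaar (u : L2T) : Lp ℂ 2 (AddCircle.haarAddCircle : Measure Torus) :=
  (memLp_haarAddCircle_iff.2 (Lp.memLp u)).toLp u

/-- `u` in `L²` of the normalized measure `dx / 2π`, regarded as an element of `L²(𝕋)`. -/
def ofHaar (u : Lp ℂ 2 (AddCircle.haarAddCircle : Measure Torus)) : L2T :=
  (memLp_haarAddCircle_iff.1 (Lp.memLp u)).toLp u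

theorem haar_absolutelyContinuous :
    (AddCircle.haarAddCircle : Measure Torus) ≪ volume := by
  rw [AddCircle.volume_eq_smul_haarAddCircle]
  exact Measure.absolutelyContinuous_smul (by simpa using Real.pi_pos)

theorem coeff_eq_repr (u : L2T) (n : ℤ) : coeff u n = fourierBasis.repr (toHaar u) n := by
  rw [fourierBasis_repr]
  exact (congrFun (fourierCoeff_congr_ae
    (MemLp.coeFn_toLp (memLp_haarAddCircle_iff.2 (Lp.memLp u)))) n).symm

theorem coeff_ofHaar (u : Lp ℂ 2 (AddCircle.haarAddCircle : Measure Torus)) (n : ℤ) :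
    coeff (ofHaar u) n = fourierBasis.repr u n := by
  rw [fourierBasis_repr]
  exact congrFun (fourierCoeff_congr_ae
    (haar_absolutelyContinuous.ae_eq (MemLp.coeFn_toLp (memLp_haarAddCircle_iff.1 (Lp.memLp u))))) n

theorem norm_phase (n : ℤ) (t : ℝ) :
    ‖Complex.exp (-Complex.I * (n : ℂ) ^ 2 * (t : ℂ))‖ = 1 := by
  have h : -Complex.I * (n : ℂ) ^ 2 * (t : ℂ) = ((-(n : ℝ) ^ 2 * t : ℝ) : ℂ) * Complex.I := by
    push_cast; ring
  rw [h, Complex.norm_exp_ofReal_mul_I]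

theorem memlp_phase_mul (t : ℝ) (u : L2T) :
    Memℓp (fun n : ℤ => Complex.exp (-Complex.I * (n : ℂ) ^ 2 * (t : ℂ)) * coeff u n) 2 := by
  have h2 : 0 < (2 : ℝ≥0∞).toReal := by norm_num
  rw [memℓp_gen_iff h2]
  have h := (memℓp_gen_iff h2).1 (lp.memℓp (fourierBasis.repr (toHaar u)))
  refine h.congr fun n => ?_
  rw [norm_mul, norm_phase, one_mul, coeff_eq_repr]

/-- The solution operator `T_t` of the linear Schrödinger equation, as the Fourier multiplier
operator on `L²(𝕋)` with symbol `e^{-in²t}`. -/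
def T (t : ℝ) (u : L2T) : L2T :=
  ofHaar (fourierBasis.repr.symm
    ⟨fun n : ℤ => Complex.exp (-Complex.I * (n : ℂ) ^ 2 * (t : ℂ)) * coeff u n,
      memlp_phase_mul t u⟩)

/-- The defining property of `T_t`. -/
theorem coeff_T (t : ℝ) (u : L2T) (n : ℤ) :
    coeff (T t u) n = Complex.exp (-Complex.I * (n : ℂ) ^ 2 * (t : ℂ)) * coeff u n := by
  rw [T, coeff_ofHaar, LinearIsometryEquiv.apply_symm_apply]

/-- `W_B(u) = ∫_0^B ∫_𝕋 |T_t u(x)|⁴ dx dt`, with values in `[0, ∞]`. -/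
def W (B : ℝ) (u : L2T) : ℝ≥0∞ :=
  ∫⁻ t in Set.Icc (0 : ℝ) B, ∫⁻ x : Torus, ‖T t u x‖ₑ ^ 4

/-- `J_{B,lam} = sup {W_B(u) : u ∈ L²(𝕋), ‖u‖² = lam}`, a supremum in `[0, ∞]`. -/
def J (B lam : ℝ) : ℝ≥0∞ := ⨆ (u : L2T) (_ : ‖u‖ ^ 2 = lam), W B u

/-- Maximizing sequences for `J_{B,lam}`. -/
def IsMaximizingSeq (B lam : ℝ) (u : ℕ → L2T) : Prop :=
  (∀ j, ‖u j‖ ^ 2 = lam) ∧ Tendsto (fun j => W B (u j)) atTop (𝓝 (J B lam))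

/-- Maximizers for `J_{B,lam}`. -/
def IsMaximizer (B lam : ℝ) (u : L2T) : Prop :=
  ‖u‖ ^ 2 = lam ∧ W B u = J B lam

/-- The representative in `[0, 2π)` of a point of the torus. -/
def angle (x : Torus) : ℝ := (AddCircle.equivIco (2 * π) 0 x : ℝ)

theorem measurable_angle : Measurable angle :=
  measurable_subtype_coe.comp (AddCircle.measurableEquivIco (2 * π) 0).measurable

theorem memLp_modulate (θ : ℝ) (u : L2T) :
    MemLp (fun x : Torus => Complex.exp (Complex.I * (θ : ℂ) * (angle x : ℂ)) * u x) 2 volume := by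
  have hm : Measurable fun x : Torus =>
      Complex.exp (Complex.I * (θ : ℂ) * (angle x : ℂ)) :=
    Complex.measurable_exp.comp
      ((Complex.measurable_ofReal.comp measurable_angle).const_mul _)
  refine (Lp.memLp u).of_le (hm.aestronglyMeasurable.mul (Lp.memLp u).1) ?_
  filter_upwards with x
  have h : Complex.I * (θ : ℂ) * (angle x : ℂ) = ((θ * angle x : ℝ) : ℂ) * Complex.I := by
    push_cast; ring
  rw [norm_mul, h, Complex.norm_exp_ofReal_mul_I, one_mul]

/-- The function `e^{iθx} u(x)` on `0 ≤ x < 2π`, as an element of `L²(𝕋)`. -/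
def modulate (θ : ℝ) (u : L2T) : L2T := (memLp_modulate θ u).toLp _

/-- For an integer `m`, `modulate m` is translation by `m` in Fourier space. -/
theorem modulate_int (m : ℤ) (u : L2T) :
    modulate (m : ℝ) u =ᵐ[volume] fun x : Torus => fourier m x * u x := by
  filter_upwards [MemLp.coeFn_toLp (memLp_modulate (m : ℝ) u)] with x hx
  rw [modulate, hx]
  have hx' : ((angle x : ℝ) : Torus) = x := AddCircle.coe_equivIco
  conv_rhs => rw [← hx', fourier_coe_apply, hx']
  congr 2
  have : (π : ℂ) ≠ 0 := by exact_mod_cast Real.pi_ne_zero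
  push_cast
  field_simp

/-- The sequence of Fourier transforms vanishes (in the sense of concentration compactness):
for each `r`, `sup_m ∑_{|n - m| ≤ r} |û_j(n)|² → 0` as `j → ∞`. -/
def FourierVanishing (u : ℕ → L2T) : Prop :=
  ∀ r : ℕ, Tendsto
    (fun j => ⨆ m : ℤ, ∑ n ∈ Finset.Icc (m - (r : ℤ)) (m + (r : ℤ)), ‖coeff (u j) n‖ₑ ^ 2)
    atTop (𝓝 0)

end

end TorusStrichartz

/-!
Write `a(n)` for the Fourier coefficients of `u`. Expanding `|T_t u|⁴` and integrating gives a sum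
over `n₁ + n₂ = n₃ + n₄`, which is parametrized by `n₁ = n`, `n₃ = n + p`, `n₄ = n + q`,
`n₂ = n + p + q`; the phase is then `2pq`. The resonant lines `p = 0` and `q = 0` contribute the
mass term `4πB (∑ |a(n)|²)² = (B / π) ‖u‖⁴`, and what is left is a form
`rem B a = ∑ κ(p,q) a(n) a(n+p+q) conj(a(n+p)) conj(a(n+q))` whose kernel is bounded by a multiple
of `w(p) w(q)`, with `w(p) = 1 / max(1, |p|)` square summable (`W_eq`).

Square summability of the weights is all that is needed: one application of the Cauchy-Schwarz
inequality (`sq_tsum_quad_le`) bounds the form by `‖a‖⁴` in `ℓ²`, and makes the contribution of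
large `p` or `q` uniformly small (`tendsto_tsum_weight`). The first fact is the Strichartz
inequality, so `J_{B,1}` is finite. The second reduces limits of `rem` to fixed `p` and `q`, and
yields two statements: `rem` tends to zero along sequences whose coefficients tend to zero uniformly
(`tendsto_rem_of_vanishing`), and `rem (a + r_j) - rem a - rem r_j → 0` if `r_j` tends to zero
weakly (`tendsto_rem_add_sub`).

For (ii) and (iii), the normalized Dirichlet kernels have uniformly small coefficients, so `W_B`
tends to `B / π` along them. They tend to zero almost everywhere, hence no subsequence of unimodular
multiples can converge in `L²` (`not_tendsto_modulate`).

For (i), let `D = J_{B,1} - B / π > 0`. Integer modulations translate the coefficients and preserve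
`W_B`, so the largest coefficient may be placed, up to a factor `2`, at the frequency `0`. A
subsequence then converges weakly to some `u₀` of mass `m`. Decoupling and homogeneity give
`D ≤ D (m² + (1 - m)²)`, so `m ∈ {0, 1}`. If `m = 0`, all coefficients would tend to zero
uniformly, forcing `W_B → B / π`. So `m = 1`, the convergence is strong, and `u₀` is a maximizer
(`exists_modulate_tendsto_maximizer`).
-/

namespace TorusStrichartz

/-! ### Quadrilinear sums over the integers -/

theorem sq_tsum_mul_le {ι : Type*} (a b : ι → ℝ≥0∞) :
    (∑' i, a i * b i) ^ 2 ≤ (∑' i, a i ^ 2) * ∑' i, b i ^ 2 := by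
  let _ : MeasurableSpace ι := ⊤
  have h := ENNReal.lintegral_mul_le_Lp_mul_Lq (Measure.count : Measure ι)
    Real.HolderConjugate.two_two (f := a) (g := b) measurable_from_top.aemeasurable
    measurable_from_top.aemeasurable
  simp only [lintegral_count, Pi.mul_apply, ENNReal.rpow_ofNat] at h
  calc (∑' i, a i * b i) ^ 2
      ≤ ((∑' i, a i ^ 2) ^ (1 / 2 : ℝ) * (∑' i, b i ^ 2) ^ (1 / 2 : ℝ)) ^ 2 := by gcongr
    _ = _ := by
      rw [mul_pow, ← ENNReal.rpow_natCast, ← ENNReal.rpow_natCast, ← ENNReal.rpow_mul,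
        ← ENNReal.rpow_mul]
      norm_num

/-- The quadrilinear estimate behind the Strichartz inequality: square summability of the two
weights suffices. The Cauchy-Schwarz inequality is applied to the grouping
`(f(p) a(n) b(n+p+q)) (g(q) c(n+p) d(n+q))`, for which the square sum of either factor is exactly a
product of `ℓ²` norms. -/
theorem sq_tsum_quad_le (f g a b c d : ℤ → ℝ≥0∞) :
    (∑' x : (ℤ × ℤ) × ℤ, f x.1.1 * g x.1.2 *
      (a x.2 * b (x.2 + x.1.1 + x.1.2) * c (x.2 + x.1.1) * d (x.2 + x.1.2))) ^ 2 ≤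
    (∑' n, f n ^ 2) * (∑' n, g n ^ 2) * (∑' n, a n ^ 2) * (∑' n, b n ^ 2) * (∑' n, c n ^ 2) *
      ∑' n, d n ^ 2 := by
  have h := sq_tsum_mul_le (fun x : (ℤ × ℤ) × ℤ => f x.1.1 * (a x.2 * b (x.2 + x.1.1 + x.1.2)))
    (fun x => g x.1.2 * (d (x.2 + x.1.2) * c (x.2 + x.1.1)))
  have h1 : ∑' x : (ℤ × ℤ) × ℤ, (f x.1.1 * (a x.2 * b (x.2 + x.1.1 + x.1.2))) ^ 2 =
      (∑' n, f n ^ 2) * ((∑' n, a n ^ 2) * ∑' n, b n ^ 2) := by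
    simp only [mul_pow, ENNReal.tsum_prod']
    rw [← ENNReal.tsum_mul_right]
    refine tsum_congr fun p => ?_
    simp only [ENNReal.tsum_mul_left]
    rw [ENNReal.tsum_comm, ← ENNReal.tsum_mul_right]
    congr 1
    refine tsum_congr fun n => ?_
    rw [ENNReal.tsum_mul_left]
    congr 1
    exact (Equiv.addLeft (n + p)).tsum_eq (fun m => b m ^ 2)
  have h2 : ∑' x : (ℤ × ℤ) × ℤ, (g x.1.2 * (d (x.2 + x.1.2) * c (x.2 + x.1.1))) ^ 2 =
      (∑' n, g n ^ 2) * ((∑' n, d n ^ 2) * ∑' n, c n ^ 2) := by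
    simp only [mul_pow, ENNReal.tsum_prod']
    rw [ENNReal.tsum_comm, ← ENNReal.tsum_mul_right]
    refine tsum_congr fun q => ?_
    simp only [ENNReal.tsum_mul_left]
    rw [ENNReal.tsum_comm, ← (Equiv.addRight q).tsum_eq (fun m => d m ^ 2),
      ← ENNReal.tsum_mul_right]
    congr 1
    refine tsum_congr fun n => ?_
    rw [ENNReal.tsum_mul_left]
    congr 1
    exact (Equiv.addLeft n).tsum_eq (fun m => c m ^ 2)
  rw [h1, h2] at h
  refine (le_of_eq (congrArg (· ^ 2) (tsum_congr fun x => ?_))).trans (h.trans (le_of_eq ?_)) <;> ring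

/-- Tail estimate: a family of nonnegative functions of `((p, q), n)` that is dominated by
products `b(n) b(n+p+q) b(n+p) b(n+q)` with `b` bounded in `ℓ²`, and whose sums over `n` tend to
zero for each fixed `(p, q)`, has weighted total sums tending to zero. The quadrilinear estimate
makes the contribution of `(p, q)` outside a large square uniformly small. -/
theorem tendsto_tsum_weight {ι : Type*} {l : Filter ι} {w : ℤ → ℝ≥0∞} (hw : ∑' n, w n ^ 2 ≠ ∞)
    {b : ι → ℤ → ℝ≥0∞} {M C : ℝ≥0∞} (hM : M ≠ ∞) (hC : C ≠ ∞) (hb : ∀ j, ∑' n, b j n ^ 2 ≤ M)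
    {Z : ι → (ℤ × ℤ) × ℤ → ℝ≥0∞}
    (hZ : ∀ j x, Z j x ≤
      C * (b j x.2 * b j (x.2 + x.1.1 + x.1.2) * b j (x.2 + x.1.1) * b j (x.2 + x.1.2)))
    (h0 : ∀ p q, Tendsto (fun j => ∑' n, Z j ((p, q), n)) l (𝓝 0)) :
    Tendsto (fun j => ∑' x : (ℤ × ℤ) × ℤ, w x.1.1 * w x.1.2 * Z j x) l (𝓝 0) := by
  classical
  have hwn : ∀ n, w n ≠ ∞ := fun n h => hw <| by
    refine top_unique ?_
    calc ∞ = w n ^ 2 := by simp [h]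
      _ ≤ _ := ENNReal.le_tsum n
  rw [ENNReal.tendsto_nhds_zero]
  intro ε hε
  -- `F` is chosen so that the two tails are at most `ε / 4` each.
  have htail : Tendsto (fun F : Finset ℤ =>
      C ^ 2 * ((∑' n : {n // n ∉ F}, w n ^ 2) * ((∑' n, w n ^ 2) * M ^ 4))) atTop (𝓝 0) := by
    have h := ENNReal.tendsto_tsum_compl_atTop_zero hw
    have h' := ENNReal.Tendsto.const_mul (a := C ^ 2)
      (ENNReal.Tendsto.mul_const (b := ((∑' n, w n ^ 2) * M ^ 4)) h
        (Or.inr (by finiteness))) (Or.inr (by finiteness))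
    simpa using h'
  have hpos : 0 < (ε / 4) ^ 2 := by
    exact pos_of_ne_zero (pow_ne_zero 2 (ENNReal.div_pos hε.ne' (by norm_num)).ne')
  obtain ⟨F, hF⟩ := ((ENNReal.tendsto_nhds_zero.1 htail) _ hpos).exists
  set v : ℤ → ℝ≥0∞ := fun n => if n ∈ F then 0 else w n with hv
  have hvS : ∑' n, v n ^ 2 = ∑' n : {n // n ∉ F}, w n ^ 2 := by
    refine Eq.trans (tsum_congr fun n => ?_)
      (tsum_subtype {n | n ∉ F} (fun n => w n ^ 2)).symm
    by_cases h : n ∈ F <;> simp [hv, h]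
  have hquad : ∀ f g : ℤ → ℝ≥0∞, ∀ j, (∑' n, f n ^ 2) * (∑' n, g n ^ 2) ≤
      (∑' n : {n // n ∉ F}, w n ^ 2) * (∑' n, w n ^ 2) →
      ∑' x : (ℤ × ℤ) × ℤ, f x.1.1 * g x.1.2 * Z j x ≤ ε / 4 := by
    intro f g j hfg
    refine (ENNReal.pow_le_pow_left_iff two_ne_zero).1 ?_
    refine le_trans ?_ hF
    have hle : ∑' x : (ℤ × ℤ) × ℤ, f x.1.1 * g x.1.2 * Z j x ≤
        C * ∑' x : (ℤ × ℤ) × ℤ, f x.1.1 * g x.1.2 * (b j x.2 * b j (x.2 + x.1.1 + x.1.2) *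
          b j (x.2 + x.1.1) * b j (x.2 + x.1.2)) := by
      rw [← ENNReal.tsum_mul_left]
      refine ENNReal.tsum_le_tsum fun x => ?_
      calc _ ≤ f x.1.1 * g x.1.2 * (C * (b j x.2 * b j (x.2 + x.1.1 + x.1.2) *
          b j (x.2 + x.1.1) * b j (x.2 + x.1.2))) := by gcongr; exact hZ j x
        _ = _ := by ring
    calc _ ≤ (C * ∑' x : (ℤ × ℤ) × ℤ, f x.1.1 * g x.1.2 *
          (b j x.2 * b j (x.2 + x.1.1 + x.1.2) * b j (x.2 + x.1.1) * b j (x.2 + x.1.2))) ^ 2 := by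
          gcongr
      _ ≤ C ^ 2 * ((∑' n, f n ^ 2) * (∑' n, g n ^ 2) * (∑' n, b j n ^ 2) * (∑' n, b j n ^ 2) *
          (∑' n, b j n ^ 2) * (∑' n, b j n ^ 2)) := by
          rw [mul_pow]
          gcongr
          exact sq_tsum_quad_le f g _ _ _ _
      _ ≤ C ^ 2 * ((∑' n : {n // n ∉ F}, w n ^ 2) * (∑' n, w n ^ 2) * M * M * M * M) := by
          gcongr <;> exact hb j
      _ = _ := by ring
  have hmain : Tendsto (fun j => ∑ x ∈ F ×ˢ F, w x.1 * w x.2 * ∑' n, Z j (x, n)) l (𝓝 0) := by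
    rw [← Finset.sum_const_zero (s := F ×ˢ F)]
    refine tendsto_finsetSum _ fun x _ => ?_
    have h := ENNReal.Tendsto.const_mul (a := w x.1 * w x.2) (h0 x.1 x.2)
      (Or.inr (ENNReal.mul_ne_top (hwn _) (hwn _)))
    simpa using h
  filter_upwards [(ENNReal.tendsto_nhds_zero.1 hmain) (ε / 2) (ENNReal.half_pos hε.ne')] with j hj
  have hsplit : ∀ x : (ℤ × ℤ) × ℤ, w x.1.1 * w x.1.2 * Z j x ≤
      (if x.1 ∈ F ×ˢ F then w x.1.1 * w x.1.2 * Z j x else 0) +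
        (v x.1.1 * w x.1.2 * Z j x + w x.1.1 * v x.1.2 * Z j x) := by
    intro x
    by_cases h1 : x.1.1 ∈ F
    · by_cases h2 : x.1.2 ∈ F
      · simp [Finset.mem_product, h1, h2]
      · simp [Finset.mem_product, h2, hv]
    · simp [Finset.mem_product, h1, hv]
  calc _ ≤ _ := ENNReal.tsum_le_tsum hsplit
    _ = ∑ x ∈ F ×ˢ F, w x.1 * w x.2 * ∑' n, Z j (x, n) + _ := by
      rw [ENNReal.tsum_add, ENNReal.tsum_prod', tsum_eq_sum (s := F ×ˢ F)
        (fun x hx => by simp only [if_neg hx, tsum_zero])]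
      congr 1
      refine Finset.sum_congr rfl fun x hx => ?_
      simp only [if_pos hx, ENNReal.tsum_mul_left]
    _ ≤ ε / 2 + (ε / 4 + ε / 4) := by
      rw [ENNReal.tsum_add]
      gcongr
      · exact hquad v w j (by rw [hvS])
      · exact hquad w v j (by rw [hvS, mul_comm])
    _ = ε := by
      have h4 : ε / 4 = ε / 2 / 2 := by
        simp only [div_eq_mul_inv, mul_assoc]
        rw [← ENNReal.mul_inv (by simp) (by simp)]
        norm_num
      rw [h4, ENNReal.add_halves, ENNReal.add_halves]

/-- If `r j → 0` pointwise and `r j` is bounded in `ℓ²`, then the `ℓ¹` pairing of `r j` with any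
translate of a fixed `ℓ²` sequence tends to zero. -/
theorem tendsto_tsum_mul_of_pointwise {ι : Type*} {l : Filter ι} {a : ℤ → ℝ≥0∞}
    (ha : ∑' n, a n ^ 2 ≠ ∞) {r : ι → ℤ → ℝ≥0∞} {M : ℝ≥0∞} (hM : M ≠ ∞)
    (hr : ∀ j, ∑' n, r j n ^ 2 ≤ M) (h0 : ∀ n, Tendsto (fun j => r j n) l (𝓝 0)) :
    Tendsto (fun j => ∑' n, a n * r j n) l (𝓝 0) := by
  classical
  have han : ∀ n, a n ≠ ∞ := fun n h => ha <| by
    refine top_unique ?_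
    calc ∞ = a n ^ 2 := by simp [h]
      _ ≤ _ := ENNReal.le_tsum n
  rw [ENNReal.tendsto_nhds_zero]
  intro ε hε
  have htail : Tendsto (fun F : Finset ℤ => (∑' n : {n // n ∉ F}, a n ^ 2) * M) atTop (𝓝 0) := by
    simpa using ENNReal.Tendsto.mul_const (b := M) (ENNReal.tendsto_tsum_compl_atTop_zero ha)
      (Or.inr hM)
  have hpos : 0 < (ε / 2) ^ 2 :=
    pos_of_ne_zero (pow_ne_zero 2 (ENNReal.half_pos hε.ne').ne')
  obtain ⟨F, hF⟩ := ((ENNReal.tendsto_nhds_zero.1 htail) _ hpos).exists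
  have hmain : Tendsto (fun j => ∑ n ∈ F, a n * r j n) l (𝓝 0) := by
    rw [← Finset.sum_const_zero (s := F)]
    refine tendsto_finsetSum _ fun n _ => ?_
    simpa using ENNReal.Tendsto.const_mul (a := a n) (h0 n) (Or.inr (han n))
  filter_upwards [(ENNReal.tendsto_nhds_zero.1 hmain) (ε / 2) (ENNReal.half_pos hε.ne')] with j hj
  have hsplit : ∑' n, a n * r j n =
      ∑ n ∈ F, a n * r j n + ∑' n : {n // n ∉ F}, a n * r j n := by
    rw [← Finset.tsum_subtype F fun n => a n * r j n]
    exact (ENNReal.summable.tsum_add_tsum_compl (s := (F : Set ℤ)) ENNReal.summable).symm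
  have htl : (∑' n : {n // n ∉ F}, a n * r j n) ^ 2 ≤ (ε / 2) ^ 2 := by
    refine (sq_tsum_mul_le (fun n : {n // n ∉ F} => a n) fun n => r j n).trans (le_trans ?_ hF)
    gcongr
    refine le_trans ?_ (hr j)
    exact ENNReal.tsum_comp_le_tsum_of_injective Subtype.val_injective fun n => r j n ^ 2
  rw [hsplit, ← ENNReal.add_halves ε]
  exact add_le_add hj ((ENNReal.pow_le_pow_left_iff two_ne_zero).1 htl)

/-! ### Fourier coefficients -/

theorem norm_sq_eq_two_pi_mul_norm_toHaar_sq (u : L2T) : ‖u‖ ^ 2 = 2 * π * ‖toHaar u‖ ^ 2 := by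
  have h1 : ‖u‖ = (eLpNorm u 2 volume).toReal := Lp.norm_def u
  have h2 : ‖toHaar u‖ = (eLpNorm u 2 (AddCircle.haarAddCircle : Measure Torus)).toReal := by
    rw [toHaar, Lp.norm_toLp]
  have h3 : ∀ f : Torus → ℂ, eLpNorm f 2 volume =
      eLpNorm f 2 (ENNReal.ofReal (2 * π) • (AddCircle.haarAddCircle : Measure Torus)) := fun f => by
    rw [AddCircle.volume_eq_smul_haarAddCircle]
  rw [h1, h2, h3, eLpNorm_smul_measure_of_ne_top (by norm_num), smul_eq_mul, ENNReal.toReal_mul,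
    mul_pow, ← ENNReal.toReal_rpow, ENNReal.toReal_ofReal Real.two_pi_pos.le, ← Real.rpow_natCast,
    ← Real.rpow_mul Real.two_pi_pos.le]
  norm_num

theorem hasSum_norm_sq_coeff (u : L2T) :
    HasSum (fun n => ‖coeff u n‖ ^ 2) (‖u‖ ^ 2 / (2 * π)) := by
  have h := lp.hasSum_norm (by norm_num : 0 < (2 : ℝ≥0∞).toReal) (fourierBasis.repr (toHaar u))
  simp only [ENNReal.toReal_ofNat, Real.rpow_ofNat, LinearIsometryEquiv.norm_map] at h
  rw [norm_sq_eq_two_pi_mul_norm_toHaar_sq, mul_div_cancel_left₀ _ Real.two_pi_pos.ne']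
  simpa only [coeff_eq_repr] using h

theorem tsum_enorm_sq_coeff (u : L2T) :
    ∑' n, ‖coeff u n‖ₑ ^ 2 = ENNReal.ofReal (‖u‖ ^ 2 / (2 * π)) := by
  have h := hasSum_norm_sq_coeff u
  rw [← h.tsum_eq, ENNReal.ofReal_tsum_of_nonneg (fun n => by positivity) h.summable]
  refine tsum_congr fun n => ?_
  rw [ENNReal.ofReal_pow (norm_nonneg _), ofReal_norm]

theorem tsum_enorm_sq_coeff_ne_top (u : L2T) : ∑' n, ‖coeff u n‖ₑ ^ 2 ≠ ∞ := by
  rw [tsum_enorm_sq_coeff]; exact ENNReal.ofReal_ne_top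

theorem integrable_haar (u : L2T) :
    Integrable (u : Torus → ℂ) (AddCircle.haarAddCircle : Measure Torus) :=
  (memLp_haarAddCircle_iff.2 (Lp.memLp u)).integrable (by norm_num)

theorem coeff_congr_ae {u : L2T} {f : Torus → ℂ} (h : u =ᵐ[volume] f) (n : ℤ) :
    coeff u n = fourierCoeff f n :=
  congrFun (fourierCoeff_congr_ae (haar_absolutelyContinuous.ae_eq h)) n

theorem coeff_add (u v : L2T) (n : ℤ) : coeff (u + v) n = coeff u n + coeff v n := by
  rw [coeff_congr_ae (Lp.coeFn_add u v), fourierCoeff.add (integrable_haar u) (integrable_haar v)]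
  rfl

theorem coeff_smul (c : ℂ) (u : L2T) (n : ℤ) : coeff (c • u) n = c * coeff u n := by
  rw [coeff_congr_ae (Lp.coeFn_smul c u)]
  exact fourierCoeff.const_smul _ c n

theorem coeff_sub (u v : L2T) (n : ℤ) : coeff (u - v) n = coeff u n - coeff v n := by
  have h := coeff_add u ((-1 : ℂ) • v) n
  rw [coeff_smul] at h
  rw [sub_eq_add_neg, ← neg_one_smul ℂ v, h]
  ring

theorem ext_coeff {u v : L2T} (h : ∀ n, coeff u n = coeff v n) : u = v := by
  have h1 := hasSum_norm_sq_coeff (u - v)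
  simp only [coeff_sub, h, sub_self, norm_zero, ne_eq, OfNat.ofNat_ne_zero, not_false_eq_true,
    zero_pow] at h1
  have h2 := h1.unique hasSum_zero
  rw [div_eq_zero_iff, or_iff_left Real.two_pi_pos.ne'] at h2
  exact sub_eq_zero.1 (norm_eq_zero.1 (pow_eq_zero_iff two_ne_zero |>.1 h2))

/-- The Riesz-Fischer theorem. -/
theorem exists_coeff_eq {a : ℤ → ℂ} (ha : ∑' n, ‖a n‖ₑ ^ 2 ≠ ∞) : ∃ u : L2T, coeff u = a := by
  have hs : Summable fun n => ‖a n‖ ^ 2 := by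
    refine (ENNReal.summable_toReal ha).congr fun n => ?_
    rw [ENNReal.toReal_pow, toReal_enorm]
  have hm : Memℓp a 2 := by
    rw [memℓp_gen_iff (by norm_num)]
    simpa using hs
  refine ⟨ofHaar (fourierBasis.repr.symm ⟨a, hm⟩), funext fun n => ?_⟩
  rw [coeff_ofHaar, LinearIsometryEquiv.apply_symm_apply]

/-- The trigonometric polynomial `∑_{n ∈ S} a_n e^{inx}` as an element of `L²(𝕋)`. -/
noncomputable def trigPoly (S : Finset ℤ) (a : ℤ → ℂ) : L2T :=
  ContinuousMap.toLp 2 volume ℂ (∑ n ∈ S, a n • (fourier n : C(Torus, ℂ)))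

theorem coeFn_trigPoly (S : Finset ℤ) (a : ℤ → ℂ) :
    trigPoly S a =ᵐ[volume] fun x : Torus => ∑ n ∈ S, a n * fourier n x := by
  refine (ContinuousMap.coeFn_toLp (p := 2) (𝕜 := ℂ) volume _).trans (ae_of_all _ fun x => ?_)
  simp [-fourier_apply]

theorem coeff_trigPoly (S : Finset ℤ) (a : ℤ → ℂ) (n : ℤ) :
    coeff (trigPoly S a) n = if n ∈ S then a n else 0 := by
  have h : trigPoly S a =ᵐ[volume] ∑ m ∈ S, a m • (fourier m : Torus → ℂ) := by
    refine (coeFn_trigPoly S a).trans (ae_of_all _ fun x => ?_)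
    simp [-fourier_apply]
  rw [coeff_congr_ae h, fourierCoeff.sum]
  · simp only [Finset.sum_apply, fourierCoeff.const_smul, fourierCoeff_fourier]
    simp [Pi.single_apply]
  · intro m _
    refine Integrable.smul _ ?_
    exact (ContinuousMap.continuous _).integrable_of_hasCompactSupport
      (HasCompactSupport.of_compactSpace _)

theorem T_trigPoly (t : ℝ) (S : Finset ℤ) (a : ℤ → ℂ) :
    T t (trigPoly S a) =
      trigPoly S fun n => Complex.exp (-Complex.I * (n : ℂ) ^ 2 * (t : ℂ)) * a n := by
  refine ext_coeff fun n => ?_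
  rw [coeff_T, coeff_trigPoly, coeff_trigPoly, mul_ite, mul_zero]

theorem T_add (t : ℝ) (u v : L2T) : T t (u + v) = T t u + T t v :=
  ext_coeff fun n => by simp only [coeff_T, coeff_add]; ring

theorem T_sub (t : ℝ) (u v : L2T) : T t (u - v) = T t u - T t v :=
  ext_coeff fun n => by simp only [coeff_T, coeff_sub]; ring

theorem T_smul (t : ℝ) (c : ℂ) (u : L2T) : T t (c • u) = c • T t u :=
  ext_coeff fun n => by simp only [coeff_T, coeff_smul]; ring

theorem norm_T (t : ℝ) (u : L2T) : ‖T t u‖ = ‖u‖ := by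
  have h := hasSum_norm_sq_coeff (T t u)
  simp only [coeff_T, norm_mul, norm_phase, one_mul] at h
  have h2 := h.unique (hasSum_norm_sq_coeff u)
  rw [div_left_inj' Real.two_pi_pos.ne'] at h2
  exact (pow_left_inj₀ (norm_nonneg _) (norm_nonneg _) two_ne_zero).1 h2

theorem coeff_modulate (m : ℤ) (u : L2T) (n : ℤ) :
    coeff (modulate (m : ℝ) u) n = coeff u (n - m) := by
  rw [coeff_congr_ae (modulate_int m u), coeff, fourierCoeff, fourierCoeff]
  refine integral_congr_ae (ae_of_all _ fun x => ?_)
  simp only [smul_eq_mul]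
  rw [← mul_assoc, ← fourier_add]
  congr 3
  ring

theorem norm_modulate (θ : ℝ) (u : L2T) : ‖modulate θ u‖ = ‖u‖ := by
  rw [modulate, Lp.norm_toLp, Lp.norm_def]
  congr 1
  refine eLpNorm_congr_norm_ae (ae_of_all _ fun x => ?_)
  have h : Complex.I * (θ : ℂ) * (angle x : ℂ) = ((θ * angle x : ℝ) : ℂ) * Complex.I := by
    push_cast; ring
  rw [norm_mul, h, Complex.norm_exp_ofReal_mul_I, one_mul]

/-- The partial sums of the Fourier series converge in `L²`. -/
theorem tendsto_trigPoly_coeff (u : L2T) :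
    Tendsto (fun S : Finset ℤ => trigPoly S (coeff u)) atTop (𝓝 u) := by
  classical
  have h0 := tendsto_tsum_compl_atTop_zero fun n => ‖coeff u n‖ ^ 2
  have h : ∀ S : Finset ℤ, ‖trigPoly S (coeff u) - u‖ ^ 2 =
      2 * π * ∑' n : {n // n ∉ S}, ‖coeff u n‖ ^ 2 := by
    intro S
    have h1 := (hasSum_norm_sq_coeff (trigPoly S (coeff u) - u)).tsum_eq
    rw [eq_div_iff Real.two_pi_pos.ne'] at h1
    rw [← h1, mul_comm]
    congr 1
    refine Eq.trans (tsum_congr fun n => ?_)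
      (tsum_subtype {n | n ∉ S} (fun n => ‖coeff u n‖ ^ 2)).symm
    rw [coeff_sub, coeff_trigPoly]
    by_cases h : n ∈ S <;> simp [h]
  rw [tendsto_iff_norm_sub_tendsto_zero]
  have h2 : Tendsto (fun S : Finset ℤ => ‖trigPoly S (coeff u) - u‖ ^ 2) atTop (𝓝 0) := by
    simp only [h]
    simpa using h0.const_mul (2 * π)
  have h3 := h2.sqrt
  simpa using h3

/-! ### The remainder form -/

open ComplexConjugate in
/-- The product `a(n) a(n+p+q) conj(a(n+p)) conj(a(n+q))` at the index `((p, q), n)`. As `p`, `q`,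
`n` vary, this runs over all `a(n₁) a(n₂) conj(a(n₃)) conj(a(n₄))` with `n₁ + n₂ = n₃ + n₄`, and
`n₁² + n₂² - n₃² - n₄² = 2pq`. -/
noncomputable def quad (a : ℤ → ℂ) (x : (ℤ × ℤ) × ℤ) : ℂ :=
  a x.2 * a (x.2 + x.1.1 + x.1.2) * conj (a (x.2 + x.1.1)) * conj (a (x.2 + x.1.2))

/-- The coefficient `2π ∫_0^B e^{-2ipqt} dt` of `quad a ((p, q), n)` in the expansion
of `W_B`. -/
noncomputable def kernel (B : ℝ) (x : ℤ × ℤ) : ℂ :=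
  2 * π * ∫ t in (0 : ℝ)..B, Complex.exp (-Complex.I * (2 * x.1 * x.2 : ℂ) * t)

/-- The kernel left over when the mass term `4πB (∑ |a(n)|²)²`, carried by `p = 0` and by
`q = 0`, is removed from `W_B`. Its value at the origin is `-2πB`, since `p = q = 0` is removed
twice. -/
noncomputable def remKernel (B : ℝ) (x : ℤ × ℤ) : ℂ :=
  kernel B x - (if x.1 = 0 then (2 * π * B : ℂ) else 0) - (if x.2 = 0 then (2 * π * B : ℂ) else 0)

/-- The remainder `W_B - 4πB (∑ |a(n)|²)²` as a function of the Fourier coefficients. -/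
noncomputable def rem (B : ℝ) (a : ℤ → ℂ) : ℂ := ∑' x, remKernel B x.1 * quad a x

/-- The square summable weight `1 / max(1, |p|)`. -/
noncomputable def weight (p : ℤ) : ℝ≥0∞ := ENNReal.ofReal (max 1 |(p : ℝ)|)⁻¹

theorem tsum_weight_sq_ne_top : ∑' p, weight p ^ 2 ≠ ∞ := by
  have hs : Summable fun p : ℤ => ((max 1 |(p : ℝ)|)⁻¹) ^ 2 := by
    have h := Real.summable_one_div_int_pow (p := 2) |>.2 (by norm_num)
    refine (h.add (hasSum_ite_eq (0 : ℤ) (1 : ℝ)).summable).of_nonneg_of_le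
      (fun p => by positivity) fun p => ?_
    by_cases hp : p = 0
    · simp [hp]
    · have h1 : (1 : ℝ) ≤ |(p : ℝ)| := by exact_mod_cast Int.one_le_abs hp
      simp [hp, max_eq_right h1]
  have h : ∀ p, weight p ^ 2 = ENNReal.ofReal (((max 1 |(p : ℝ)|)⁻¹) ^ 2) := fun p => by
    rw [weight, ENNReal.ofReal_pow (by positivity)]
  simp only [h]
  rw [← ENNReal.ofReal_tsum_of_nonneg (fun p => by positivity) hs]
  exact ENNReal.ofReal_ne_top

theorem kernel_of_mul_eq_zero {B : ℝ} {x : ℤ × ℤ} (h : x.1 * x.2 = 0) :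
    kernel B x = 2 * π * B := by
  have h' : (x.1 * x.2 : ℂ) = 0 := by exact_mod_cast h
  simp [kernel, mul_assoc, h']

/-- On the axes the remainder kernel vanishes, except for the value `-2πB` at the origin; off the
axes the oscillatory integral `∫_0^B e^{-2ipqt} dt` is at most `1 / |pq|`. -/
theorem norm_remKernel_le {B : ℝ} (hB : 0 < B) (x : ℤ × ℤ) :
    ‖remKernel B x‖ ≤ 2 * π * max 1 B * ((max 1 |(x.1 : ℝ)|)⁻¹ * (max 1 |(x.2 : ℝ)|)⁻¹) := by
  by_cases h1 : x.1 = 0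
  · rw [remKernel, kernel_of_mul_eq_zero (by simp [h1])]
    by_cases h2 : x.2 = 0
    · simpa [h1, h2, abs_of_pos hB, abs_of_pos Real.pi_pos] using
        mul_le_mul_of_nonneg_left (le_max_right 1 B) Real.two_pi_pos.le
    · simp only [h1, h2, if_true, if_false, sub_self, norm_zero]
      positivity
  by_cases h2 : x.2 = 0
  · rw [remKernel, kernel_of_mul_eq_zero (by simp [h2])]
    simp only [h1, h2, if_true, if_false, sub_zero, sub_self, norm_zero]
    positivity
  have h1' : (1 : ℝ) ≤ |(x.1 : ℝ)| := by exact_mod_cast Int.one_le_abs h1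
  have h2' : (1 : ℝ) ≤ |(x.2 : ℝ)| := by exact_mod_cast Int.one_le_abs h2
  rw [max_eq_right h1', max_eq_right h2']
  have hc : -Complex.I * (2 * x.1 * x.2 : ℂ) ≠ 0 := by
    simp [h1, h2]
  have hn : ‖-Complex.I * (2 * x.1 * x.2 : ℂ)‖ = 2 * (|(x.1 : ℝ)| * |(x.2 : ℝ)|) := by
    simp [mul_assoc]
  have he : ∀ t : ℝ, ‖Complex.exp (-Complex.I * (2 * x.1 * x.2 : ℂ) * t)‖ = 1 := fun t => by
    have : -Complex.I * (2 * x.1 * x.2 : ℂ) * t = ((-(2 * x.1 * x.2) * t : ℝ) : ℂ) * Complex.I := by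
      push_cast; ring
    rw [this, Complex.norm_exp_ofReal_mul_I]
  have hint : ‖∫ t in (0 : ℝ)..B, Complex.exp (-Complex.I * (2 * x.1 * x.2 : ℂ) * t)‖ ≤
      |(x.1 : ℝ)|⁻¹ * |(x.2 : ℝ)|⁻¹ := by
    rw [integral_exp_mul_complex hc, norm_div, hn, ← mul_inv, div_le_iff₀ (by positivity)]
    calc _ ≤ (1 : ℝ) + 1 := (norm_sub_le _ _).trans (by rw [he, he])
      _ = _ := by field_simp; norm_num
  simp only [remKernel, h1, h2, if_false, sub_zero, kernel, norm_mul]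
  have hpi : ‖(2 : ℂ)‖ * ‖(π : ℂ)‖ = 2 * π := by simp [abs_of_pos Real.pi_pos]
  rw [hpi]
  calc 2 * π * _ ≤ 2 * π * (|(x.1 : ℝ)|⁻¹ * |(x.2 : ℝ)|⁻¹) := by gcongr
    _ ≤ 2 * π * max 1 B * (|(x.1 : ℝ)|⁻¹ * |(x.2 : ℝ)|⁻¹) := by
      refine mul_le_mul_of_nonneg_right ?_ (by positivity)
      exact le_mul_of_one_le_right Real.two_pi_pos.le (le_max_left _ _)

theorem enorm_remKernel_le {B : ℝ} (hB : 0 < B) (x : ℤ × ℤ) :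
    ‖remKernel B x‖ₑ ≤ ENNReal.ofReal (2 * π * max 1 B) * (weight x.1 * weight x.2) := by
  rw [weight, weight, ← ENNReal.ofReal_mul (by positivity), ← ENNReal.ofReal_mul (by positivity),
    ← ofReal_norm]
  exact ENNReal.ofReal_le_ofReal (norm_remKernel_le hB x)

theorem enorm_quad (a : ℤ → ℂ) (x : (ℤ × ℤ) × ℤ) : ‖quad a x‖ₑ =
    ‖a x.2‖ₑ * ‖a (x.2 + x.1.1 + x.1.2)‖ₑ * ‖a (x.2 + x.1.1)‖ₑ * ‖a (x.2 + x.1.2)‖ₑ := by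
  simp only [quad, enorm_mul, RCLike.enorm_conj]

theorem tsum_enorm_remKernel_mul_le {B : ℝ} (hB : 0 < B) (Z : (ℤ × ℤ) × ℤ → ℂ) :
    ∑' x, ‖remKernel B x.1 * Z x‖ₑ ≤
      ENNReal.ofReal (2 * π * max 1 B) * ∑' x, weight x.1.1 * weight x.1.2 * ‖Z x‖ₑ := by
  rw [← ENNReal.tsum_mul_left]
  refine ENNReal.tsum_le_tsum fun x => ?_
  rw [enorm_mul, ← mul_assoc]
  gcongr
  exact enorm_remKernel_le hB x.1

theorem sq_tsum_weight_quad_le (a : ℤ → ℂ) :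
    (∑' x, weight x.1.1 * weight x.1.2 * ‖quad a x‖ₑ) ^ 2 ≤
      ((∑' p, weight p ^ 2) * (∑' n, ‖a n‖ₑ ^ 2) ^ 2) ^ 2 := by
  simp only [enorm_quad]
  refine (sq_tsum_quad_le weight weight (fun n => ‖a n‖ₑ) (fun n => ‖a n‖ₑ) (fun n => ‖a n‖ₑ)
    (fun n => ‖a n‖ₑ)).trans (le_of_eq ?_)
  ring

theorem tsum_enorm_rem_le {B : ℝ} (hB : 0 < B) (a : ℤ → ℂ) :
    ∑' x, ‖remKernel B x.1 * quad a x‖ₑ ≤ ENNReal.ofReal (2 * π * max 1 B) *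
      ((∑' p, weight p ^ 2) * (∑' n, ‖a n‖ₑ ^ 2) ^ 2) := by
  refine (tsum_enorm_remKernel_mul_le hB _).trans ?_
  gcongr
  exact (ENNReal.pow_le_pow_left_iff two_ne_zero).1 (sq_tsum_weight_quad_le a)

theorem summable_rem {B : ℝ} (hB : 0 < B) {a : ℤ → ℂ} (ha : ∑' n, ‖a n‖ₑ ^ 2 ≠ ∞) :
    Summable fun x => remKernel B x.1 * quad a x := by
  have hw := tsum_weight_sq_ne_top
  refine Summable.of_enorm (ne_top_of_le_ne_top ?_ (tsum_enorm_rem_le hB a))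
  finiteness

theorem enorm_rem_le {B : ℝ} (hB : 0 < B) (a : ℤ → ℂ) :
    ‖rem B a‖ₑ ≤ ENNReal.ofReal (2 * π * max 1 B) *
      ((∑' p, weight p ^ 2) * (∑' n, ‖a n‖ₑ ^ 2) ^ 2) :=
  enorm_tsum_le_tsum_enorm.trans (tsum_enorm_rem_le hB a)

/-- Invariance of the remainder under translation of the Fourier variable. -/
theorem rem_shift (B : ℝ) (a : ℤ → ℂ) (m : ℤ) : rem B (fun n => a (n - m)) = rem B a := by
  rw [rem, rem, ← ((Equiv.refl (ℤ × ℤ)).prodCongr (Equiv.subRight m)).tsum_eq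
    fun x => remKernel B x.1 * quad a x]
  refine tsum_congr fun x => ?_
  simp only [quad, Equiv.prodCongr_apply, Prod.map, Equiv.refl_apply, Equiv.subRight_apply]
  congr 5 <;> ring_nf

theorem add_sq_le_two_mul (x y : ℝ≥0∞) : (x + y) ^ 2 ≤ 2 * x ^ 2 + 2 * y ^ 2 := by
  have h := ENNReal.rpow_add_le_mul_rpow_add_rpow x y (p := 2) (by norm_num)
  norm_num at h
  rwa [← mul_add]

/-- A sequence whose Fourier coefficients are bounded in `ℓ²` and tend to zero uniformly has
vanishing remainder. -/
theorem tendsto_rem_of_vanishing {ι : Type*} {l : Filter ι} {B : ℝ} (hB : 0 < B)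
    {a : ι → ℤ → ℂ} {M : ℝ≥0∞} (hM : M ≠ ∞) (ha : ∀ j, ∑' n, ‖a j n‖ₑ ^ 2 ≤ M)
    {s : ι → ℝ≥0∞} (hs : Tendsto s l (𝓝 0)) (has : ∀ j n, ‖a j n‖ₑ ≤ s j) :
    Tendsto (fun j => rem B (a j)) l (𝓝 0) := by
  have h1 : Tendsto (fun j => ∑' x, weight x.1.1 * weight x.1.2 * ‖quad (a j) x‖ₑ) l (𝓝 0) := by
    refine tendsto_tsum_weight tsum_weight_sq_ne_top hM ENNReal.one_ne_top ha
      (fun j x => by rw [one_mul, enorm_quad]) fun p q => ?_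
    have hb : ∀ j, ∑' n, ‖quad (a j) ((p, q), n)‖ₑ ≤ s j ^ 2 * (M + M) := by
      intro j
      calc _ ≤ ∑' n, s j ^ 2 * (‖a j n‖ₑ ^ 2 + ‖a j (n + p)‖ₑ ^ 2) := by
            refine ENNReal.tsum_le_tsum fun n => ?_
            rw [enorm_quad]
            calc _ ≤ ‖a j n‖ₑ * s j * ‖a j (n + p)‖ₑ * s j := by gcongr <;> exact has j _
              _ = s j ^ 2 * (‖a j n‖ₑ * ‖a j (n + p)‖ₑ) := by ring
              _ ≤ _ := by
                gcongr
                rcases le_total ‖a j n‖ₑ ‖a j (n + p)‖ₑ with h | h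
                · exact (mul_le_mul_left h _).trans (by rw [← sq]; exact le_add_self)
                · exact (mul_le_mul_right h _).trans (by rw [← sq]; exact le_self_add)
        _ ≤ _ := by
            rw [ENNReal.tsum_mul_left, ENNReal.tsum_add]
            gcongr
            · exact ha j
            · exact ((Equiv.addRight p).tsum_eq fun n => ‖a j n‖ₑ ^ 2).trans_le (ha j)
    have h0 : Tendsto (fun j => s j ^ 2 * (M + M)) l (𝓝 0) := by
      have := ENNReal.Tendsto.mul_const (b := M + M) (ENNReal.Tendsto.pow (n := 2) hs)
        (Or.inr (by finiteness))
      simpa using this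
    exact tendsto_of_tendsto_of_tendsto_of_le_of_le tendsto_const_nhds h0 (fun _ => zero_le) hb
  rw [tendsto_zero_iff_enorm_tendsto_zero]
  have h2 := ENNReal.Tendsto.const_mul (a := ENNReal.ofReal (2 * π * max 1 B)) h1
    (Or.inr ENNReal.ofReal_ne_top)
  rw [mul_zero] at h2
  exact tendsto_of_tendsto_of_tendsto_of_le_of_le tendsto_const_nhds h2 (fun _ => zero_le)
    fun j => enorm_tsum_le_tsum_enorm.trans (tsum_enorm_remKernel_mul_le hB _)

/-- The mixed terms in a product of four sums are controlled by pair products. -/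
theorem enorm_prod_add_sub_le {N : ℝ≥0∞} {a₁ a₂ a₃ a₄ r₁ r₂ r₃ r₄ : ℂ}
    (ha₁ : ‖a₁‖ₑ ≤ N) (ha₂ : ‖a₂‖ₑ ≤ N) (ha₃ : ‖a₃‖ₑ ≤ N) (ha₄ : ‖a₄‖ₑ ≤ N)
    (hr₁ : ‖r₁‖ₑ ≤ N) (hr₂ : ‖r₂‖ₑ ≤ N) (hr₃ : ‖r₃‖ₑ ≤ N) (hr₄ : ‖r₄‖ₑ ≤ N) :
    ‖(a₁ + r₁) * (a₂ + r₂) * (a₃ + r₃) * (a₄ + r₄) - a₁ * a₂ * a₃ * a₄ - r₁ * r₂ * r₃ * r₄‖ₑ ≤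
      4 * N ^ 2 * (‖a₁‖ₑ * ‖r₃‖ₑ + ‖a₃‖ₑ * ‖r₁‖ₑ + ‖a₁‖ₑ * ‖r₂‖ₑ + ‖a₂‖ₑ * ‖r₁‖ₑ +
        ‖a₃‖ₑ * ‖r₄‖ₑ + ‖a₄‖ₑ * ‖r₃‖ₑ) := by
  have h : (a₁ + r₁) * (a₂ + r₂) * (a₃ + r₃) * (a₄ + r₄) - a₁ * a₂ * a₃ * a₄ - r₁ * r₂ * r₃ * r₄ =
      (a₂ * r₄) * (a₁ * r₃) + (r₂ * a₄) * (a₃ * r₁) + ((a₃ + r₃) * (a₄ + r₄)) * (a₁ * r₂) +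
      ((a₃ + r₃) * (a₄ + r₄)) * (a₂ * r₁) + (a₁ * a₂ + r₁ * r₂) * (a₃ * r₄) +
      (a₁ * a₂ + r₁ * r₂) * (a₄ * r₃) := by ring
  have hX : ‖(a₃ + r₃) * (a₄ + r₄)‖ₑ ≤ 4 * N ^ 2 := by
    rw [enorm_mul]
    calc _ ≤ (N + N) * (N + N) :=
          mul_le_mul' ((enorm_add_le _ _).trans (add_le_add ha₃ hr₃))
            ((enorm_add_le _ _).trans (add_le_add ha₄ hr₄))
      _ = _ := by ring
  have hY : ‖a₁ * a₂ + r₁ * r₂‖ₑ ≤ 4 * N ^ 2 := by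
    calc _ ≤ N * N + N * N := (enorm_add_le _ _).trans (by
          rw [enorm_mul, enorm_mul]; gcongr)
      _ = 2 * N ^ 2 := by ring
      _ ≤ _ := by gcongr; norm_num
  have hU : ∀ {x y : ℂ}, ‖x‖ₑ ≤ N → ‖y‖ₑ ≤ N → ‖x * y‖ₑ ≤ 4 * N ^ 2 := by
    intro x y hx hy
    calc _ ≤ N * N := by rw [enorm_mul]; gcongr
      _ = 1 * N ^ 2 := by ring
      _ ≤ _ := by gcongr; norm_num
  rw [h]
  simp only [mul_add, ← enorm_mul]
  refine (enorm_add_le _ _).trans (add_le_add ?_ ?_)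
  · refine (enorm_add_le _ _).trans (add_le_add ?_ ?_)
    · refine (enorm_add_le _ _).trans (add_le_add ?_ ?_)
      · refine (enorm_add_le _ _).trans (add_le_add ?_ ?_)
        · refine (enorm_add_le _ _).trans (add_le_add ?_ ?_)
          · exact (enorm_mul _ _).trans_le (mul_le_mul' (hU ha₂ hr₄) le_rfl)
          · exact (enorm_mul _ _).trans_le (mul_le_mul' (hU hr₂ ha₄) le_rfl)
        · exact (enorm_mul _ _).trans_le (mul_le_mul' (by simpa only [mul_add] using hX) le_rfl)
      · exact (enorm_mul _ _).trans_le (mul_le_mul' (by simpa only [mul_add] using hX) le_rfl)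
    · exact (enorm_mul _ _).trans_le (mul_le_mul' hY le_rfl)
  · exact (enorm_mul _ _).trans_le (mul_le_mul' hY le_rfl)

theorem enorm_le_one_add_tsum_sq (a : ℤ → ℂ) (n : ℤ) : ‖a n‖ₑ ≤ 1 + ∑' n, ‖a n‖ₑ ^ 2 := by
  rcases le_total ‖a n‖ₑ 1 with h | h
  · exact h.trans le_self_add
  · calc _ ≤ ‖a n‖ₑ ^ 2 := by rw [sq]; exact le_mul_of_one_le_right' h
      _ ≤ _ := (ENNReal.le_tsum (f := fun n => ‖a n‖ₑ ^ 2) n).trans le_add_self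

/-- Decoupling of the remainder (an analogue of the Brezis-Lieb lemma): if `r j` is bounded
in `ℓ²` and tends to zero pointwise, the mixed terms of `rem (a + r j)` tend to zero. -/
theorem tendsto_rem_add_sub {ι : Type*} {l : Filter ι} {B : ℝ} (hB : 0 < B)
    {a : ℤ → ℂ} (ha : ∑' n, ‖a n‖ₑ ^ 2 ≠ ∞) {r : ι → ℤ → ℂ} {M : ℝ≥0∞} (hM : M ≠ ∞)
    (hr : ∀ j, ∑' n, ‖r j n‖ₑ ^ 2 ≤ M) (h0 : ∀ n, Tendsto (fun j => r j n) l (𝓝 0)) :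
    Tendsto (fun j => rem B (a + r j) - rem B a - rem B (r j)) l (𝓝 0) := by
  set Z : ι → (ℤ × ℤ) × ℤ → ℂ := fun j x => quad (a + r j) x - quad a x - quad (r j) x with hZ
  have hsum : ∀ j, ∑' n, ‖(a + r j) n‖ₑ ^ 2 ≤ 2 * (∑' n, ‖a n‖ₑ ^ 2) + 2 * M := fun j => by
    calc _ ≤ ∑' n, (2 * ‖a n‖ₑ ^ 2 + 2 * ‖r j n‖ₑ ^ 2) := by
          refine ENNReal.tsum_le_tsum fun n => le_trans ?_ (add_sq_le_two_mul _ _)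
          gcongr
          exact enorm_add_le _ _
      _ ≤ _ := by
          rw [ENNReal.tsum_add, ENNReal.tsum_mul_left, ENNReal.tsum_mul_left]
          gcongr
          exact hr j
  have hrem : ∀ j, rem B (a + r j) - rem B a - rem B (r j) = ∑' x, remKernel B x.1 * Z j x := by
    intro j
    have s1 := summable_rem hB (ne_top_of_le_ne_top (by finiteness) (hsum j))
    have s2 := summable_rem hB ha
    have s3 := summable_rem hB (ne_top_of_le_ne_top hM (hr j))
    rw [rem, rem, rem, ← s1.tsum_sub s2, ← (s1.sub s2).tsum_sub s3]
    refine tsum_congr fun x => ?_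
    simp only [hZ]
    ring
  have hab : ∀ j, ∑' n, (‖a n‖ₑ + ‖r j n‖ₑ) ^ 2 ≤ 2 * (∑' n, ‖a n‖ₑ ^ 2) + 2 * M := fun j => by
    calc _ ≤ ∑' n, (2 * ‖a n‖ₑ ^ 2 + 2 * ‖r j n‖ₑ ^ 2) :=
          ENNReal.tsum_le_tsum fun n => add_sq_le_two_mul _ _
      _ ≤ _ := by
          rw [ENNReal.tsum_add, ENNReal.tsum_mul_left, ENNReal.tsum_mul_left]
          gcongr
          exact hr j
  have h1 : Tendsto (fun j => ∑' x, weight x.1.1 * weight x.1.2 * ‖Z j x‖ₑ) l (𝓝 0) := by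
    refine tendsto_tsum_weight tsum_weight_sq_ne_top
      (M := 2 * (∑' n, ‖a n‖ₑ ^ 2) + 2 * M) (C := 3) (by finiteness) (by finiteness) hab
      (fun j x => ?_) fun p q => ?_
    -- Each of the three products is dominated by the product of the values of `|a| + |r j|`.
    · calc ‖Z j x‖ₑ ≤ ‖quad (a + r j) x‖ₑ + ‖quad a x‖ₑ + ‖quad (r j) x‖ₑ :=
            (enorm_sub_le).trans (add_le_add enorm_sub_le le_rfl)
        _ ≤ _ := by
          simp only [enorm_quad, Pi.add_apply]
          have e : ∀ y : ℝ≥0∞, 3 * y = y + y + y := fun y => by ring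
          rw [e]
          gcongr
          all_goals first | exact enorm_add_le _ _ | exact le_self_add | exact le_add_self
    -- For fixed `(p, q)`, only pairings of `a` with a translate of `r j` occur.
    · set N : ℝ≥0∞ := (1 + ∑' n, ‖a n‖ₑ ^ 2) + (1 + M) with hN
      have haN : ∀ n, ‖a n‖ₑ ≤ N := fun n => (enorm_le_one_add_tsum_sq a n).trans le_self_add
      have hrN : ∀ j n, ‖r j n‖ₑ ≤ N := fun j n =>
        (enorm_le_one_add_tsum_sq (r j) n).trans ((add_le_add le_rfl (hr j)).trans le_add_self)
      have hpair : ∀ u v : ℤ → ℤ, Function.Bijective u → (∃ h, ∀ n, v n = u n + h) →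
          Tendsto (fun j => ∑' n, ‖a (u n)‖ₑ * ‖r j (v n)‖ₑ) l (𝓝 0) := by
        rintro u v hu ⟨h, hv⟩
        have := tendsto_tsum_mul_of_pointwise (l := l) (a := fun n => ‖a n‖ₑ) ha
          (r := fun j n => ‖r j (n + h)‖ₑ) hM
          (fun j => ((Equiv.addRight h).tsum_eq fun n => ‖r j n‖ₑ ^ 2).trans_le (hr j))
          (fun n => tendsto_zero_iff_enorm_tendsto_zero.1 (h0 (n + h)))
        refine this.congr fun j => ?_
        simp only [hv]
        exact ((Equiv.ofBijective u hu).tsum_eq fun n => ‖a n‖ₑ * ‖r j (n + h)‖ₑ).symm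
      have b1 : Function.Bijective fun n : ℤ => n := Function.bijective_id
      have b2 : Function.Bijective fun n : ℤ => n + p + q :=
        ((Equiv.addRight p).trans (Equiv.addRight q)).bijective
      have b3 : Function.Bijective fun n : ℤ => n + p := (Equiv.addRight p).bijective
      have b4 : Function.Bijective fun n : ℤ => n + q := (Equiv.addRight q).bijective
      have hlim := (((((hpair _ (fun n => n + p) b1 ⟨p, fun n => rfl⟩).add
        (hpair _ (fun n => n) b3 ⟨-p, fun n => by ring⟩)).add
        (hpair _ (fun n => n + p + q) b1 ⟨p + q, fun n => by ring⟩)).add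
        (hpair _ (fun n => n) b2 ⟨-p - q, fun n => by ring⟩)).add
        (hpair _ (fun n => n + q) b3 ⟨q - p, fun n => by ring⟩)).add
        (hpair _ (fun n => n + p) b4 ⟨p - q, fun n => by ring⟩)
      have hlim' := ENNReal.Tendsto.const_mul (a := 4 * N ^ 2) hlim (Or.inr (by finiteness))
      simp only [add_zero, mul_zero] at hlim'
      refine tendsto_of_tendsto_of_tendsto_of_le_of_le tendsto_const_nhds hlim'
        (fun _ => zero_le) fun j => ?_
      simp only [← ENNReal.tsum_add, ← ENNReal.tsum_mul_left]
      refine ENNReal.tsum_le_tsum fun n => ?_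
      have := enorm_prod_add_sub_le (N := N) (a₁ := a n) (a₂ := a (n + p + q))
        (a₃ := starRingEnd ℂ (a (n + p))) (a₄ := starRingEnd ℂ (a (n + q))) (r₁ := r j n)
        (r₂ := r j (n + p + q)) (r₃ := starRingEnd ℂ (r j (n + p)))
        (r₄ := starRingEnd ℂ (r j (n + q))) (haN _) (haN _)
        (by rw [RCLike.enorm_conj]; exact haN _) (by rw [RCLike.enorm_conj]; exact haN _)
        (hrN j _) (hrN j _) (by rw [RCLike.enorm_conj]; exact hrN j _)
        (by rw [RCLike.enorm_conj]; exact hrN j _)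
      simpa only [RCLike.enorm_conj, hZ, quad, Pi.add_apply, map_add] using this
  rw [tendsto_zero_iff_enorm_tendsto_zero]
  have h2 := ENNReal.Tendsto.const_mul (a := ENNReal.ofReal (2 * π * max 1 B)) h1
    (Or.inr ENNReal.ofReal_ne_top)
  rw [mul_zero] at h2
  refine tendsto_of_tendsto_of_tendsto_of_le_of_le tendsto_const_nhds h2 (fun _ => zero_le)
    fun j => ?_
  rw [hrem]
  exact enorm_tsum_le_tsum_enorm.trans (tsum_enorm_remKernel_mul_le hB _)

/-- Continuity of the remainder for convergence in `ℓ²`. -/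
theorem tendsto_rem {ι : Type*} {l : Filter ι} {B : ℝ} (hB : 0 < B)
    {a : ℤ → ℂ} (ha : ∑' n, ‖a n‖ₑ ^ 2 ≠ ∞) {r : ι → ℤ → ℂ} {M : ℝ≥0∞} (hM : M ≠ ∞)
    (hr : ∀ j, ∑' n, ‖r j n‖ₑ ^ 2 ≤ M) (h0 : Tendsto (fun j => ∑' n, ‖r j n‖ₑ ^ 2) l (𝓝 0)) :
    Tendsto (fun j => rem B (a + r j)) l (𝓝 (rem B a)) := by
  have hpt : ∀ n, Tendsto (fun j => r j n) l (𝓝 0) := fun n => by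
    rw [tendsto_zero_iff_enorm_tendsto_zero, ENNReal.tendsto_nhds_zero]
    intro ε hε
    filter_upwards [(ENNReal.tendsto_nhds_zero.1 h0) (ε ^ 2) (pos_of_ne_zero
      (pow_ne_zero 2 hε.ne'))] with j hj
    exact (ENNReal.pow_le_pow_left_iff two_ne_zero).1
      ((ENNReal.le_tsum (f := fun n => ‖r j n‖ₑ ^ 2) n).trans hj)
  have h1 : Tendsto (fun j => rem B (r j)) l (𝓝 0) := by
    rw [tendsto_zero_iff_enorm_tendsto_zero]
    have hw := tsum_weight_sq_ne_top
    have h2 : Tendsto (fun j => ENNReal.ofReal (2 * π * max 1 B) *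
        ((∑' p, weight p ^ 2) * (∑' n, ‖r j n‖ₑ ^ 2) ^ 2)) l (𝓝 0) := by
      have := ENNReal.Tendsto.const_mul (a := ENNReal.ofReal (2 * π * max 1 B))
        (ENNReal.Tendsto.const_mul (a := ∑' p, weight p ^ 2) (ENNReal.Tendsto.pow (n := 2) h0)
          (Or.inr hw))
        (Or.inr ENNReal.ofReal_ne_top)
      simpa using this
    exact tendsto_of_tendsto_of_tendsto_of_le_of_le tendsto_const_nhds h2 (fun _ => zero_le)
      fun j => enorm_rem_le hB _
  have h2 := ((tendsto_rem_add_sub hB ha hM hr hpt).add h1).add_const (rem B a)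
  simp only [zero_add, add_zero] at h2
  exact h2.congr fun j => by ring

/-! ### The `L⁴` functional and trigonometric polynomials -/

/-- The functional `v ↦ ∫_𝕋 |v|⁴ dx` on `L²(𝕋)` is lower semicontinuous, by Fatou's lemma. -/
theorem lowerSemicontinuous_lintegral_pow_four :
    LowerSemicontinuous fun v : L2T => ∫⁻ x : Torus, ‖v x‖ₑ ^ 4 := by
  rw [lowerSemicontinuous_iff_isClosed_preimage]
  intro c
  refine IsSeqClosed.isClosed fun v u hv hu => ?_
  obtain ⟨φ, -, hφ⟩ := (tendstoInMeasure_of_tendsto_Lp hu).exists_seq_tendsto_ae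
  have hlim : ∀ᵐ x : Torus, ‖u x‖ₑ ^ 4 = liminf (fun k => ‖v (φ k) x‖ₑ ^ 4) atTop := by
    filter_upwards [hφ] with x hx
    exact (ENNReal.Tendsto.pow (n := 4) hx.enorm).liminf_eq.symm
  calc ∫⁻ x : Torus, ‖u x‖ₑ ^ 4
      = ∫⁻ x : Torus, liminf (fun k => ‖v (φ k) x‖ₑ ^ 4) atTop := lintegral_congr_ae hlim
    _ ≤ liminf (fun k => ∫⁻ x : Torus, ‖v (φ k) x‖ₑ ^ 4) atTop :=
        lintegral_liminf_le' fun k => (Lp.aestronglyMeasurable _).enorm.pow_const 4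
    _ ≤ liminf (fun _ : ℕ => c) atTop := liminf_le_liminf (Eventually.of_forall fun k => hv (φ k))
    _ = c := liminf_const c

theorem continuous_T (u : L2T) : Continuous fun t => T t u := by
  refine continuous_iff_continuousAt.2 fun s => ?_
  have hn : ∀ t, ‖T t u - T s u‖ ^ 2 = 2 * π * ∑' n : ℤ,
      ‖(Complex.exp (-Complex.I * (n : ℂ) ^ 2 * (t : ℂ)) -
        Complex.exp (-Complex.I * (n : ℂ) ^ 2 * (s : ℂ))) * coeff u n‖ ^ 2 := fun t => by
    have h := (hasSum_norm_sq_coeff (T t u - T s u)).tsum_eq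
    rw [eq_div_iff Real.two_pi_pos.ne'] at h
    rw [← h, mul_comm]
    simp only [coeff_sub, coeff_T, sub_mul]
  have hb : Summable fun n => 4 * ‖coeff u n‖ ^ 2 := (hasSum_norm_sq_coeff u).summable.mul_left 4
  have h0 : Tendsto (fun t => ‖T t u - T s u‖ ^ 2) (𝓝 s) (𝓝 0) := by
    simp only [hn]
    have : Tendsto (fun t : ℝ => ∑' n : ℤ,
      ‖(Complex.exp (-Complex.I * (n : ℂ) ^ 2 * (t : ℂ)) -
        Complex.exp (-Complex.I * (n : ℂ) ^ 2 * (s : ℂ))) * coeff u n‖ ^ 2) (𝓝 s)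
        (𝓝 (∑' _ : ℤ, 0)) := by
      refine tendsto_tsum_of_dominated_convergence hb (fun n => ?_)
        (Eventually.of_forall fun t n => ?_)
      · have : Continuous fun t : ℝ => ‖(Complex.exp (-Complex.I * (n : ℂ) ^ 2 * (t : ℂ)) -
            Complex.exp (-Complex.I * (n : ℂ) ^ 2 * (s : ℂ))) * coeff u n‖ ^ 2 := by fun_prop
        simpa using this.tendsto s
      · rw [norm_mul, mul_pow, Real.norm_of_nonneg (by positivity)]
        have : ‖Complex.exp (-Complex.I * (n : ℂ) ^ 2 * (t : ℂ)) -
            Complex.exp (-Complex.I * (n : ℂ) ^ 2 * (s : ℂ))‖ ≤ 2 :=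
          (norm_sub_le _ _).trans (by rw [norm_phase, norm_phase]; norm_num)
        have h2 : ‖Complex.exp (-Complex.I * (n : ℂ) ^ 2 * (t : ℂ)) -
            Complex.exp (-Complex.I * (n : ℂ) ^ 2 * (s : ℂ))‖ ^ 2 ≤ 4 :=
          (pow_le_pow_left₀ (norm_nonneg _) this 2).trans (by norm_num)
        gcongr
    simpa using this.const_mul (2 * π)
  rw [ContinuousAt, tendsto_iff_norm_sub_tendsto_zero]
  simpa using h0.sqrt

theorem measurable_lintegral_T (u : L2T) : Measurable fun t => ∫⁻ x : Torus, ‖T t u x‖ₑ ^ 4 :=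
  (lowerSemicontinuous_lintegral_pow_four.comp (continuous_T u)).measurable

/-- `W_B` is lower semicontinuous, by Fatou's lemma in the time variable. -/
theorem W_le_liminf (B : ℝ) {v : ℕ → L2T} {u : L2T} (hv : Tendsto v atTop (𝓝 u)) :
    W B u ≤ liminf (fun j => W B (v j)) atTop := by
  refine le_trans (lintegral_mono fun t => ?_)
    (lintegral_liminf_le fun j => measurable_lintegral_T (v j))
  have hT : Tendsto (fun j => T t (v j)) atTop (𝓝 (T t u)) := by
    rw [tendsto_iff_norm_sub_tendsto_zero] at hv ⊢
    simpa only [← T_sub, norm_T] using hv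
  exact (lowerSemicontinuous_lintegral_pow_four.le_liminf (T t u)).trans
    (liminf_le_liminf_of_le hT)

theorem lintegral_pow_four_add_le (u v : L2T) :
    (∫⁻ x : Torus, ‖(u + v : L2T) x‖ₑ ^ 4) ^ (1 / 4 : ℝ) ≤
      (∫⁻ x : Torus, ‖u x‖ₑ ^ 4) ^ (1 / 4 : ℝ) + (∫⁻ x : Torus, ‖v x‖ₑ ^ 4) ^ (1 / 4 : ℝ) := by
  have h := ENNReal.lintegral_Lp_add_le (μ := (volume : Measure Torus)) (p := 4)
    (f := fun x => ‖u x‖ₑ) (g := fun x => ‖v x‖ₑ) (Lp.aestronglyMeasurable _).enorm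
    (Lp.aestronglyMeasurable _).enorm (by norm_num)
  simp only [Pi.add_apply, ENNReal.rpow_ofNat] at h
  refine le_trans (ENNReal.rpow_le_rpow (lintegral_mono_ae ?_) (by norm_num)) h
  filter_upwards [Lp.coeFn_add u v] with x hx
  rw [hx, Pi.add_apply]
  gcongr
  exact enorm_add_le _ _

/-- `W_B^{1/4}` is the norm of `T_t u` in `L⁴([0, B] × 𝕋)`, and as such subadditive. -/
theorem W_rpow_add_le (B : ℝ) (u v : L2T) :
    W B (u + v) ^ (1 / 4 : ℝ) ≤ W B u ^ (1 / 4 : ℝ) + W B v ^ (1 / 4 : ℝ) := by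
  have e : ∀ y : ℝ≥0∞, (y ^ (1 / 4 : ℝ)) ^ 4 = y := fun y => by
    rw [← ENNReal.rpow_natCast, ← ENNReal.rpow_mul]; norm_num
  have h := ENNReal.lintegral_Lp_add_le (μ := (volume : Measure ℝ).restrict (Set.Icc 0 B)) (p := 4)
    (f := fun t => (∫⁻ x : Torus, ‖T t u x‖ₑ ^ 4) ^ (1 / 4 : ℝ))
    (g := fun t => (∫⁻ x : Torus, ‖T t v x‖ₑ ^ 4) ^ (1 / 4 : ℝ))
    ((measurable_lintegral_T u).pow_const _).aemeasurable
    ((measurable_lintegral_T v).pow_const _).aemeasurable (by norm_num)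
  simp only [Pi.add_apply, ENNReal.rpow_ofNat, e] at h
  refine le_trans (ENNReal.rpow_le_rpow (lintegral_mono fun t => ?_) (by norm_num)) h
  rw [← e (∫⁻ x : Torus, ‖T t (u + v) x‖ₑ ^ 4), T_add]
  gcongr
  exact lintegral_pow_four_add_le _ _

theorem W_smul (B : ℝ) (c : ℂ) (u : L2T) : W B (c • u) = ‖c‖ₑ ^ 4 * W B u := by
  have h : ∀ t, ∫⁻ x : Torus, ‖T t (c • u) x‖ₑ ^ 4 =
      ‖c‖ₑ ^ 4 * ∫⁻ x : Torus, ‖T t u x‖ₑ ^ 4 := fun t => by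
    rw [← lintegral_const_mul' _ _ (by finiteness), T_smul]
    refine lintegral_congr_ae ?_
    filter_upwards [Lp.coeFn_smul c (T t u)] with x hx
    rw [hx, Pi.smul_apply, enorm_smul, mul_pow]
  simp only [W, h]
  exact lintegral_const_mul' _ _ (by finiteness)

/-- For finitely supported coefficients, sums against `quad` in the variables `(p, q, n)` are sums
in the variables `n`, `m = n + p`, `l = n + q`. -/
theorem tsum_mul_quad_eq_sum {S : Finset ℤ} {a : ℤ → ℂ} (ha : ∀ n ∉ S, a n = 0)
    (k : ℤ × ℤ → ℂ) :
    ∑' x, k x.1 * quad a x = ∑ n ∈ S, ∑ m ∈ S, ∑ l ∈ S, k (m - n, l - n) *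
      (a n * a (m + l - n) * starRingEnd ℂ (a m) * starRingEnd ℂ (a l)) := by
  let e : (ℤ × ℤ × ℤ) ≃ (ℤ × ℤ) × ℤ :=
    { toFun := fun y => ((y.2.1 - y.1, y.2.2 - y.1), y.1)
      invFun := fun x => (x.2, x.2 + x.1.1, x.2 + x.1.2)
      left_inv := fun y => by simp
      right_inv := fun x => by simp }
  rw [← e.tsum_eq, tsum_eq_sum (s := S ×ˢ S ×ˢ S)]
  · rw [Finset.sum_product]
    refine Finset.sum_congr rfl fun n _ => ?_
    rw [Finset.sum_product]
    refine Finset.sum_congr rfl fun m _ => Finset.sum_congr rfl fun l _ => ?_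
    simp only [e, Equiv.coe_fn_mk, quad]
    rw [show n + (m - n) + (l - n) = m + l - n by ring, add_sub_cancel, add_sub_cancel]
  · rintro ⟨n, m, l⟩ h
    simp only [Finset.mem_product, not_and_or] at h
    simp only [e, Equiv.coe_fn_mk, quad, add_sub_cancel]
    rcases h with h | h | h <;> simp [ha _ h]

theorem integral_fourier (j : ℤ) :
    ∫ x : Torus, (fourier j x : ℂ) = if j = 0 then (2 * π : ℂ) else 0 := by
  have h := congrFun (fourierCoeff_fourier (T := 2 * π) j) 0
  rw [fourierCoeff, AddCircle.integral_haarAddCircle] at h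
  simp only [neg_zero, fourier_zero, one_smul] at h
  rw [inv_smul_eq_iff₀ Real.two_pi_pos.ne'] at h
  rw [h]
  by_cases hj : j = 0 <;> simp [hj, Ne.symm]

open ComplexConjugate in
/-- The fourth power of the `L⁴` norm of a trigonometric polynomial. -/
theorem integral_norm_pow_four (S : Finset ℤ) {b : ℤ → ℂ} (hb : ∀ n ∉ S, b n = 0) :
    ((∫ x : Torus, ‖∑ n ∈ S, b n * fourier n x‖ ^ 4 : ℝ) : ℂ) =
      ∑ n ∈ S, ∑ m ∈ S, ∑ l ∈ S, 2 * π * (b n * b (m + l - n) * conj (b m) * conj (b l)) := by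
  have hexp : ∀ x : Torus, ((‖∑ n ∈ S, b n * fourier n x‖ ^ 4 : ℝ) : ℂ) =
      ∑ n ∈ S, ∑ m ∈ S, ∑ l ∈ S, ∑ k ∈ S,
        (b n * b k * conj (b m) * conj (b l)) * fourier (k - (m + l - n)) x := by
    intro x
    have hz : ∀ z : ℂ, ((‖z‖ ^ 4 : ℝ) : ℂ) = z * (conj z * (conj z * z)) := fun z => by
      have := Complex.mul_conj' z
      push_cast
      linear_combination (-z * conj z - (‖z‖ : ℂ) ^ 2) * this
    rw [hz, Finset.sum_mul]
    refine Finset.sum_congr rfl fun n _ => ?_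
    rw [map_sum, Finset.sum_mul, Finset.mul_sum]
    refine Finset.sum_congr rfl fun m _ => ?_
    rw [Finset.sum_mul, Finset.mul_sum, Finset.mul_sum]
    refine Finset.sum_congr rfl fun l _ => ?_
    rw [Finset.mul_sum, Finset.mul_sum, Finset.mul_sum]
    refine Finset.sum_congr rfl fun k _ => ?_
    rw [show k - (m + l - n) = n + (-m + (-l + k)) by ring, fourier_add, fourier_add, fourier_add,
      fourier_neg, fourier_neg, map_mul, map_mul]
    ring
  have hint : ∀ (c : ℂ) (j : ℤ), Integrable fun x : Torus => c * fourier j x := fun c j => by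
    refine Continuous.integrable_of_hasCompactSupport ?_ (HasCompactSupport.of_compactSpace _)
    exact continuous_const.mul (ContinuousMap.continuous _)
  rw [← integral_complex_ofReal]
  simp only [hexp]
  rw [integral_finsetSum _ fun n _ => integrable_finsetSum _ fun m _ => integrable_finsetSum _
    fun l _ => integrable_finsetSum _ fun k _ => hint _ _]
  refine Finset.sum_congr rfl fun n _ => ?_
  rw [integral_finsetSum _ fun m _ => integrable_finsetSum _
    fun l _ => integrable_finsetSum _ fun k _ => hint _ _]
  refine Finset.sum_congr rfl fun m _ => ?_
  rw [integral_finsetSum _ fun l _ => integrable_finsetSum _ fun k _ => hint _ _]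
  refine Finset.sum_congr rfl fun l _ => ?_
  rw [integral_finsetSum _ fun k _ => hint _ _]
  simp only [integral_const_mul, integral_fourier, sub_eq_zero, mul_ite, mul_zero,
    Finset.sum_ite_eq']
  split_ifs with h
  · ring
  · rw [hb _ h]; ring

/-! ### The Strichartz inequality and the expansion of `W_B` -/

open ComplexConjugate in
/-- The resonance identity `n² + (m+l-n)² - m² - l² = 2(m-n)(l-n)` in exponential form. -/
theorem phase_mul_phase (a : ℤ → ℂ) (t : ℝ) (n m l : ℤ) :
    (Complex.exp (-Complex.I * (n : ℂ) ^ 2 * (t : ℂ)) * a n) *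
      (Complex.exp (-Complex.I * ((m + l - n : ℤ) : ℂ) ^ 2 * (t : ℂ)) * a (m + l - n)) *
      conj (Complex.exp (-Complex.I * (m : ℂ) ^ 2 * (t : ℂ)) * a m) *
      conj (Complex.exp (-Complex.I * (l : ℂ) ^ 2 * (t : ℂ)) * a l) =
    Complex.exp (-Complex.I * (2 * (m - n : ℤ) * (l - n : ℤ) : ℂ) * t) *
      (a n * a (m + l - n) * conj (a m) * conj (a l)) := by
  have h : Complex.exp (-Complex.I * (2 * (m - n : ℤ) * (l - n : ℤ) : ℂ) * t) =
      Complex.exp (-Complex.I * (n : ℂ) ^ 2 * (t : ℂ)) *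
      Complex.exp (-Complex.I * ((m + l - n : ℤ) : ℂ) ^ 2 * (t : ℂ)) *
      conj (Complex.exp (-Complex.I * (m : ℂ) ^ 2 * (t : ℂ))) *
      conj (Complex.exp (-Complex.I * (l : ℂ) ^ 2 * (t : ℂ))) := by
    rw [← Complex.exp_conj, ← Complex.exp_conj, ← Complex.exp_add, ← Complex.exp_add,
      ← Complex.exp_add]
    congr 1
    simp only [map_mul, map_neg, map_pow, Complex.conj_I, Complex.conj_ofReal, map_intCast]
    push_cast
    ring
  rw [h, map_mul, map_mul]
  ring

theorem coeff_trigPoly_of_support {S : Finset ℤ} {a : ℤ → ℂ} (ha : ∀ n ∉ S, a n = 0) :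
    coeff (trigPoly S a) = a := funext fun n => by
  rw [coeff_trigPoly]
  split_ifs with h
  · rfl
  · exact (ha n h).symm

theorem norm_trigPoly_sq {S : Finset ℤ} {a : ℤ → ℂ} (ha : ∀ n ∉ S, a n = 0) :
    ‖trigPoly S a‖ ^ 2 = 2 * π * ∑ n ∈ S, ‖a n‖ ^ 2 := by
  have h := (hasSum_norm_sq_coeff (trigPoly S a)).tsum_eq
  rw [coeff_trigPoly_of_support ha, tsum_eq_sum (s := S) (fun n hn => by simp [ha n hn]),
    eq_div_iff Real.two_pi_pos.ne'] at h
  rw [← h, mul_comm]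

/-- The expansion of `W_B` into its mass term and the remainder, for trigonometric polynomials. -/
theorem W_trigPoly {B : ℝ} (hB : 0 < B) {S : Finset ℤ} {a : ℤ → ℂ} (ha : ∀ n ∉ S, a n = 0) :
    W B (trigPoly S a) ≠ ∞ ∧ ((W B (trigPoly S a)).toReal : ℂ) =
      (B / π * ‖trigPoly S a‖ ^ 4 : ℝ) + rem B a := by
  set b : ℝ → ℤ → ℂ := fun t n => Complex.exp (-Complex.I * (n : ℂ) ^ 2 * (t : ℂ)) * a n with hb
  set h : ℤ → ℤ → ℤ → ℂ := fun n m l =>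
    a n * a (m + l - n) * starRingEnd ℂ (a m) * starRingEnd ℂ (a l) with hh
  set G : ℝ → ℝ := fun t => ∫ x : Torus, ‖∑ n ∈ S, b t n * fourier n x‖ ^ 4 with hG
  have hGc : ∀ t, (G t : ℂ) = ∑ n ∈ S, ∑ m ∈ S, ∑ l ∈ S, 2 * π *
      (Complex.exp (-Complex.I * (2 * (m - n : ℤ) * (l - n : ℤ) : ℂ) * t) * h n m l) := fun t => by
    rw [hG]
    simp only
    rw [integral_norm_pow_four S (fun n hn => by simp [hb, ha n hn])]
    simp only [hb, hh, phase_mul_phase]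
  have hcont : ∀ n m l : ℤ, Continuous fun t : ℝ => 2 * π *
      (Complex.exp (-Complex.I * (2 * (m - n : ℤ) * (l - n : ℤ) : ℂ) * t) * h n m l) := by
    intro n m l; fun_prop
  have hGcont : Continuous G := by
    have h1 : Continuous fun t => (G t : ℂ) := by
      simp only [hGc]
      exact continuous_finsetSum _ fun n _ => continuous_finsetSum _ fun m _ =>
        continuous_finsetSum _ fun l _ => hcont n m l
    exact Complex.continuous_re.comp h1
  have hG0 : ∀ t, 0 ≤ G t := fun t => integral_nonneg fun x => by positivity
  have hinner : ∀ t, ∫⁻ x : Torus, ‖T t (trigPoly S a) x‖ₑ ^ 4 = ENNReal.ofReal (G t) := by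
    intro t
    rw [hG, ofReal_integral_eq_lintegral_ofReal]
    · rw [T_trigPoly]
      refine lintegral_congr_ae ?_
      filter_upwards [coeFn_trigPoly S (b t)] with x hx
      rw [hx, ENNReal.ofReal_pow (norm_nonneg _), ofReal_norm]
    · refine Continuous.integrable_of_hasCompactSupport ?_ (HasCompactSupport.of_compactSpace _)
      exact (continuous_finsetSum _ fun n _ =>
        continuous_const.mul (ContinuousMap.continuous _)).norm.pow 4
    · exact ae_of_all _ fun x => by positivity
  have hW : W B (trigPoly S a) = ENNReal.ofReal (∫ t in (0 : ℝ)..B, G t) := by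
    simp only [W, hinner]
    rw [← ofReal_integral_eq_lintegral_ofReal hGcont.continuousOn.integrableOn_Icc
      (ae_of_all _ hG0), intervalIntegral.integral_of_le hB.le, integral_Icc_eq_integral_Ioc]
  refine ⟨by rw [hW]; exact ENNReal.ofReal_ne_top, ?_⟩
  rw [hW, ENNReal.toReal_ofReal (intervalIntegral.integral_nonneg hB.le fun t _ => hG0 t),
    ← intervalIntegral.integral_ofReal]
  simp only [hGc]
  have hker : ∫ t in (0 : ℝ)..B, ∑ n ∈ S, ∑ m ∈ S, ∑ l ∈ S, 2 * π *
      (Complex.exp (-Complex.I * (2 * (m - n : ℤ) * (l - n : ℤ) : ℂ) * t) * h n m l) =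
      ∑ n ∈ S, ∑ m ∈ S, ∑ l ∈ S, kernel B (m - n, l - n) * h n m l := by
    rw [intervalIntegral.integral_finsetSum fun n _ => Continuous.intervalIntegrable
      (continuous_finsetSum _ fun m _ => continuous_finsetSum _ fun l _ => hcont n m l) _ _]
    refine Finset.sum_congr rfl fun n _ => ?_
    rw [intervalIntegral.integral_finsetSum fun m _ => Continuous.intervalIntegrable
      (continuous_finsetSum _ fun l _ => hcont n m l) _ _]
    refine Finset.sum_congr rfl fun m _ => ?_
    rw [intervalIntegral.integral_finsetSum fun l _ => (hcont n m l).intervalIntegrable _ _]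
    refine Finset.sum_congr rfl fun l _ => ?_
    rw [intervalIntegral.integral_const_mul, intervalIntegral.integral_mul_const, kernel,
      mul_assoc (2 * (π : ℂ))]
  have hsq : ∀ z : ℂ, z * starRingEnd ℂ z = (‖z‖ : ℂ) ^ 2 := Complex.mul_conj'
  -- The two resonant lines `m = n` and `l = n` each carry the square of the mass.
  have hres1 : ∑ n ∈ S, ∑ m ∈ S, ∑ l ∈ S, (if m - n = 0 then (2 * π * B : ℂ) else 0) * h n m l =
      2 * π * B * ((∑ n ∈ S, ‖a n‖ ^ 2 : ℝ) : ℂ) ^ 2 := by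
    push_cast
    rw [sq, Finset.sum_mul, Finset.mul_sum]
    refine Finset.sum_congr rfl fun n hn => ?_
    rw [Finset.mul_sum, Finset.mul_sum, Finset.sum_comm]
    refine Finset.sum_congr rfl fun l _ => ?_
    simp only [sub_eq_zero, ite_mul, zero_mul, Finset.sum_ite_eq', hn, if_true, hh,
      add_sub_cancel_left]
    rw [← hsq, ← hsq]
    ring
  have hres2 : ∑ n ∈ S, ∑ m ∈ S, ∑ l ∈ S, (if l - n = 0 then (2 * π * B : ℂ) else 0) * h n m l =
      2 * π * B * ((∑ n ∈ S, ‖a n‖ ^ 2 : ℝ) : ℂ) ^ 2 := by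
    push_cast
    rw [sq, Finset.sum_mul, Finset.mul_sum]
    refine Finset.sum_congr rfl fun n hn => ?_
    rw [Finset.mul_sum, Finset.mul_sum]
    refine Finset.sum_congr rfl fun m _ => ?_
    simp only [sub_eq_zero, ite_mul, zero_mul, Finset.sum_ite_eq', hn, if_true, hh,
      add_sub_cancel_right]
    rw [← hsq, ← hsq]
    ring
  have hrem : rem B a = ∑ n ∈ S, ∑ m ∈ S, ∑ l ∈ S, kernel B (m - n, l - n) * h n m l -
      2 * π * B * ((∑ n ∈ S, ‖a n‖ ^ 2 : ℝ) : ℂ) ^ 2 -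
      2 * π * B * ((∑ n ∈ S, ‖a n‖ ^ 2 : ℝ) : ℂ) ^ 2 := by
    conv_rhs => rw [← hres1]
    nth_rewrite 2 [← hres2.trans hres1.symm]
    rw [rem, tsum_mul_quad_eq_sum ha]
    simp only [← Finset.sum_sub_distrib, ← sub_mul]
    rfl
  rw [hker, hrem, show ‖trigPoly S a‖ ^ 4 = (‖trigPoly S a‖ ^ 2) ^ 2 by ring, norm_trigPoly_sq ha]
  have hpi : (π : ℂ) ≠ 0 := by exact_mod_cast Real.pi_ne_zero
  push_cast
  field_simp
  ring

/-- Trigonometric polynomials are dense in `L²(𝕋)`. -/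
theorem exists_seq_trigPoly (u : L2T) : ∃ v : ℕ → L2T, (∀ j, ∃ (S : Finset ℤ) (a : ℤ → ℂ),
    (∀ n ∉ S, a n = 0) ∧ v j = trigPoly S a) ∧ Tendsto v atTop (𝓝 u) := by
  obtain ⟨φ, hφ⟩ := exists_seq_tendsto (atTop : Filter (Finset ℤ))
  refine ⟨fun j => trigPoly (φ j) (coeff u), fun j =>
    ⟨φ j, coeff (trigPoly (φ j) (coeff u)), ?_, ?_⟩, (tendsto_trigPoly_coeff u).comp hφ⟩
  · intro n hn
    rw [coeff_trigPoly, if_neg hn]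
  · refine ext_coeff fun n => ?_
    rw [coeff_trigPoly, coeff_trigPoly, coeff_trigPoly]
    split_ifs <;> rfl

theorem ofReal_norm_pow (u : L2T) (k : ℕ) : ENNReal.ofReal (‖u‖ ^ k) = ‖u‖ₑ ^ k := by
  rw [ENNReal.ofReal_pow (norm_nonneg _), ofReal_norm]

/-- The Strichartz inequality on the torus. -/
theorem exists_W_le {B : ℝ} (hB : 0 < B) : ∃ K : ℝ≥0∞, K ≠ ∞ ∧ ∀ u, W B u ≤ K * ‖u‖ₑ ^ 4 := by
  have hw := tsum_weight_sq_ne_top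
  refine ⟨ENNReal.ofReal (B / π) + ENNReal.ofReal (2 * π * max 1 B) *
    ((∑' p, weight p ^ 2) * ENNReal.ofReal (2 * π)⁻¹ ^ 2), by finiteness, fun u => ?_⟩
  set K := ENNReal.ofReal (B / π) + ENNReal.ofReal (2 * π * max 1 B) *
    ((∑' p, weight p ^ 2) * ENNReal.ofReal (2 * π)⁻¹ ^ 2) with hK
  obtain ⟨v, hv, hvu⟩ := exists_seq_trigPoly u
  have hb : ∀ j, W B (v j) ≤ K * ‖v j‖ₑ ^ 4 := by
    intro j
    obtain ⟨S, a, ha, hva⟩ := hv j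
    obtain ⟨hfin, hid⟩ := W_trigPoly hB ha
    rw [← hva] at hfin hid
    have hca : coeff (v j) = a := by rw [hva, coeff_trigPoly_of_support ha]
    have hS := tsum_enorm_sq_coeff (v j)
    rw [hca] at hS
    calc W B (v j) = ‖((W B (v j)).toReal : ℂ)‖ₑ := by
          rw [← ofReal_norm, Complex.norm_of_nonneg ENNReal.toReal_nonneg,
            ENNReal.ofReal_toReal hfin]
      _ ≤ ‖((B / π * ‖v j‖ ^ 4 : ℝ) : ℂ)‖ₑ + ‖rem B a‖ₑ := by
          rw [hid]; exact enorm_add_le _ _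
      _ ≤ ENNReal.ofReal (B / π) * ‖v j‖ₑ ^ 4 + ENNReal.ofReal (2 * π * max 1 B) *
          ((∑' p, weight p ^ 2) * (ENNReal.ofReal (2 * π)⁻¹ * ‖v j‖ₑ ^ 2) ^ 2) := by
          refine add_le_add (le_of_eq ?_) ((enorm_rem_le hB a).trans (le_of_eq ?_))
          · rw [← ofReal_norm, Complex.norm_of_nonneg (by positivity),
              ENNReal.ofReal_mul (by positivity), ofReal_norm_pow]
          · rw [hS, div_eq_inv_mul, ENNReal.ofReal_mul (p := (2 * π)⁻¹) (by positivity),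
              ofReal_norm_pow]
      _ = _ := by rw [hK]; ring
  have hlim : Tendsto (fun j => K * ‖v j‖ₑ ^ 4) atTop (𝓝 (K * ‖u‖ₑ ^ 4)) :=
    ENNReal.Tendsto.const_mul (ENNReal.Tendsto.pow hvu.enorm) (Or.inr (by rw [hK]; finiteness))
  calc W B u ≤ liminf (fun j => W B (v j)) atTop := W_le_liminf B hvu
    _ ≤ liminf (fun j => K * ‖v j‖ₑ ^ 4) atTop := liminf_le_liminf (Eventually.of_forall hb)
    _ = _ := hlim.liminf_eq

theorem W_ne_top {B : ℝ} (hB : 0 < B) (u : L2T) : W B u ≠ ∞ := by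
  obtain ⟨K, hK, h⟩ := exists_W_le hB
  exact ne_top_of_le_ne_top (by finiteness) (h u)

theorem tendsto_W {B : ℝ} (hB : 0 < B) {v : ℕ → L2T} {u : L2T} (hv : Tendsto v atTop (𝓝 u)) :
    Tendsto (fun j => W B (v j)) atTop (𝓝 (W B u)) := by
  obtain ⟨K, hK, hle⟩ := exists_W_le hB
  have hd : ∀ j, W B (v j - u) ^ (1 / 4 : ℝ) ≤ K ^ (1 / 4 : ℝ) * ‖v j - u‖ₑ := fun j => by
    refine (ENNReal.rpow_le_rpow (hle _) (by norm_num)).trans (le_of_eq ?_)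
    rw [ENNReal.mul_rpow_of_nonneg _ _ (by norm_num), ← ENNReal.rpow_natCast, ← ENNReal.rpow_mul]
    norm_num
  have h0 : Tendsto (fun j => K ^ (1 / 4 : ℝ) * ‖v j - u‖ₑ) atTop (𝓝 0) := by
    have h1 : Tendsto (fun j => ‖v j - u‖ₑ) atTop (𝓝 0) := by
      simpa using (hv.sub_const u).enorm
    simpa using ENNReal.Tendsto.const_mul (a := K ^ (1 / 4 : ℝ)) h1 (Or.inr (by finiteness))
  have hup : ∀ j, W B (v j) ^ (1 / 4 : ℝ) ≤
      W B u ^ (1 / 4 : ℝ) + K ^ (1 / 4 : ℝ) * ‖v j - u‖ₑ := fun j => by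
    have := W_rpow_add_le B u (v j - u)
    rw [add_sub_cancel] at this
    exact this.trans (add_le_add le_rfl (hd j))
  have h2 : Tendsto (fun j => (W B u ^ (1 / 4 : ℝ) + K ^ (1 / 4 : ℝ) * ‖v j - u‖ₑ) ^ 4) atTop
      (𝓝 (W B u)) := by
    have h3 := ENNReal.Tendsto.pow (n := 4) (h0.const_add (W B u ^ (1 / 4 : ℝ)))
    have e : (W B u ^ (1 / 4 : ℝ) + 0) ^ 4 = W B u := by
      rw [add_zero, ← ENNReal.rpow_natCast, ← ENNReal.rpow_mul]; norm_num
    rwa [e] at h3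
  refine tendsto_of_le_liminf_of_limsup_le (W_le_liminf B hv) ?_
  rw [← h2.limsup_eq]
  refine limsup_le_limsup (Eventually.of_forall fun j => ?_)
  have e : W B (v j) = (W B (v j) ^ (1 / 4 : ℝ)) ^ 4 := by
    rw [← ENNReal.rpow_natCast, ← ENNReal.rpow_mul]; norm_num
  simp only
  rw [e]
  gcongr
  exact hup j

theorem tendsto_rem_coeff {B : ℝ} (hB : 0 < B) {v : ℕ → L2T} {u : L2T}
    (hv : Tendsto v atTop (𝓝 u)) :
    Tendsto (fun j => rem B (coeff (v j))) atTop (𝓝 (rem B (coeff u))) := by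
  have h0 : Tendsto (fun j => ‖v j - u‖ ^ 2 / (2 * π)) atTop (𝓝 0) := by
    have := ((tendsto_iff_norm_sub_tendsto_zero.1 hv).pow 2).div_const (2 * π)
    simpa using this
  obtain ⟨M, hM⟩ := h0.bddAbove_range
  have h := tendsto_rem (l := atTop) hB (tsum_enorm_sq_coeff_ne_top u)
    (r := fun j => coeff (v j - u)) (M := ENNReal.ofReal M) ENNReal.ofReal_ne_top
    (fun j => by
      rw [tsum_enorm_sq_coeff]
      exact ENNReal.ofReal_le_ofReal (hM ⟨j, rfl⟩))
    (by simpa only [tsum_enorm_sq_coeff, ENNReal.ofReal_zero] using ENNReal.tendsto_ofReal h0)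
  refine h.congr fun j => congrArg (rem B) (funext fun n => ?_)
  rw [Pi.add_apply, coeff_sub, add_sub_cancel]

/-- The expansion of `W_B` into its mass term and the remainder. -/
theorem W_eq {B : ℝ} (hB : 0 < B) (u : L2T) :
    ((W B u).toReal : ℂ) = (B / π * ‖u‖ ^ 4 : ℝ) + rem B (coeff u) := by
  obtain ⟨v, hv, hvu⟩ := exists_seq_trigPoly u
  have h1 : Tendsto (fun j => ((W B (v j)).toReal : ℂ)) atTop (𝓝 ((W B u).toReal : ℂ)) :=
    (Complex.continuous_ofReal.tendsto _).comp
      ((ENNReal.tendsto_toReal (W_ne_top hB u)).comp (tendsto_W hB hvu))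
  have h2 : Tendsto (fun j => ((B / π * ‖v j‖ ^ 4 : ℝ) : ℂ) + rem B (coeff (v j))) atTop
      (𝓝 (((B / π * ‖u‖ ^ 4 : ℝ) : ℂ) + rem B (coeff u))) :=
    ((Complex.continuous_ofReal.tendsto _).comp ((hvu.norm.pow 4).const_mul (B / π))).add
      (tendsto_rem_coeff hB hvu)
  refine tendsto_nhds_unique h1 (h2.congr fun j => ?_)
  obtain ⟨S, a, ha, hva⟩ := hv j
  rw [hva, coeff_trigPoly_of_support ha, (W_trigPoly hB ha).2]

/-! ### Consequences of the expansion -/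

/-- Galilean invariance of `W_B`. -/
theorem W_modulate {B : ℝ} (hB : 0 < B) (m : ℤ) (u : L2T) : W B (modulate (m : ℝ) u) = W B u := by
  rw [← ENNReal.toReal_eq_toReal_iff' (W_ne_top hB _) (W_ne_top hB _), ← Complex.ofReal_inj,
    W_eq hB, W_eq hB, norm_modulate, ← rem_shift B (coeff u) m]
  congr 2
  exact funext fun n => coeff_modulate m u n

theorem re_rem {B : ℝ} (hB : 0 < B) (u : L2T) :
    (rem B (coeff u)).re = (W B u).toReal - B / π * ‖u‖ ^ 4 := by
  have h := congrArg Complex.re (W_eq hB u)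
  rw [Complex.add_re, Complex.ofReal_re, Complex.ofReal_re] at h
  linarith

/-- Along a normalized sequence whose Fourier coefficients tend to zero uniformly, only the mass
term of `W_B` survives. -/
theorem tendsto_W_of_vanishing {B : ℝ} (hB : 0 < B) {u : ℕ → L2T} (hu : ∀ j, ‖u j‖ ^ 2 = 1)
    {s : ℕ → ℝ≥0∞} (hs : Tendsto s atTop (𝓝 0)) (hus : ∀ j n, ‖coeff (u j) n‖ₑ ≤ s j) :
    Tendsto (fun j => W B (u j)) atTop (𝓝 (ENNReal.ofReal (B / π))) := by
  have h := tendsto_rem_of_vanishing hB (a := fun j => coeff (u j))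
    (M := ENNReal.ofReal (1 / (2 * π))) ENNReal.ofReal_ne_top
    (fun j => by rw [tsum_enorm_sq_coeff, hu]) hs hus
  have h1 := (Complex.continuous_re.tendsto _).comp h
  have h2 : Tendsto (fun j => B / π + (rem B (coeff (u j))).re) atTop (𝓝 (B / π)) := by
    simpa using h1.const_add (B / π)
  refine (ENNReal.tendsto_ofReal h2).congr fun j => ?_
  rw [re_rem hB, show ‖u j‖ ^ 4 = (‖u j‖ ^ 2) ^ 2 by ring, hu]
  simp [ENNReal.ofReal_toReal (W_ne_top hB _)]

theorem J_one_lt_top {B : ℝ} (hB : 0 < B) : J B 1 < ∞ := by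
  obtain ⟨K, hK, h⟩ := exists_W_le hB
  refine lt_of_le_of_lt (iSup₂_le fun u hu => ?_) hK.lt_top
  refine (h u).trans (le_of_eq ?_)
  rw [← ofReal_norm_pow, show ‖u‖ ^ 4 = (‖u‖ ^ 2) ^ 2 by ring, hu]
  simp

theorem W_le_J (B : ℝ) {u : L2T} (hu : ‖u‖ ^ 2 = 1) : W B u ≤ J B 1 :=
  le_iSup₂ (f := fun (u : L2T) (_ : ‖u‖ ^ 2 = 1) => W B u) u hu

/-- `W_B` is homogeneous of degree four. -/
theorem toReal_W_le {B : ℝ} (hB : 0 < B) (u : L2T) :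
    (W B u).toReal ≤ (J B 1).toReal * ‖u‖ ^ 4 := by
  by_cases h0 : u = 0
  · have : W B (0 : L2T) = 0 := by
      have := W_smul B 0 (0 : L2T)
      simpa using this
    simp [h0, this]
  have hn : ‖u‖ ≠ 0 := norm_ne_zero_iff.2 h0
  set w : L2T := ((‖u‖⁻¹ : ℝ) : ℂ) • u with hw
  have hw1 : ‖w‖ ^ 2 = 1 := by
    rw [hw, norm_smul, Complex.norm_real, norm_inv, norm_norm, inv_mul_cancel₀ hn, one_pow]
  have hu : u = ((‖u‖ : ℝ) : ℂ) • w := by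
    rw [hw, smul_smul, ← Complex.ofReal_mul, mul_inv_cancel₀ hn, Complex.ofReal_one, one_smul]
  have h : W B u = ‖u‖ₑ ^ 4 * W B w := by
    conv_lhs => rw [hu, W_smul]
    congr 2
    rw [← ofReal_norm, Complex.norm_real, norm_norm, ofReal_norm]
  rw [h, ENNReal.toReal_mul, ENNReal.toReal_pow, toReal_enorm, mul_comm]
  gcongr
  · exact (J_one_lt_top hB).ne
  · exact W_le_J B hw1

theorem re_rem_le {B : ℝ} (hB : 0 < B) (u : L2T) :
    (rem B (coeff u)).re ≤ ((J B 1).toReal - B / π) * ‖u‖ ^ 4 := by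
  rw [re_rem hB, sub_mul]
  linarith [toReal_W_le hB u]

/-! ### Normalized Dirichlet kernels -/

/-- The `L²`-normalized Dirichlet kernel `(2πN)^{-1/2} ∑_{0 ≤ n < N} e^{inx}`, with `N = j + 1`. -/
noncomputable def dirichlet (j : ℕ) : L2T :=
  trigPoly ((Finset.range (j + 1)).map Nat.castEmbedding)
    fun n => if n ∈ (Finset.range (j + 1)).map (Nat.castEmbedding (R := ℤ)) then
      (((√(2 * π * (j + 1)))⁻¹ : ℝ) : ℂ) else 0

theorem norm_dirichlet_sq (j : ℕ) : ‖dirichlet j‖ ^ 2 = 1 := by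
  rw [dirichlet, norm_trigPoly_sq (fun n hn => if_neg hn)]
  have : ∀ n ∈ (Finset.range (j + 1)).map (Nat.castEmbedding (R := ℤ)),
      ‖(if n ∈ (Finset.range (j + 1)).map (Nat.castEmbedding (R := ℤ)) then
      (((√(2 * π * (j + 1)))⁻¹ : ℝ) : ℂ) else 0)‖ ^ 2 = (2 * π * (j + 1))⁻¹ := fun n hn => by
    rw [if_pos hn, Complex.norm_real, norm_inv, Real.norm_of_nonneg (Real.sqrt_nonneg _), inv_pow,
      Real.sq_sqrt (by positivity)]
  rw [Finset.sum_congr rfl this, Finset.sum_const, Finset.card_map, Finset.card_range, nsmul_eq_mul]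
  push_cast
  field_simp

theorem tendsto_dirichlet_height :
    Tendsto (fun j : ℕ => (√(2 * π * (j + 1)))⁻¹) atTop (𝓝 0) := by
  refine tendsto_inv_atTop_zero.comp (Real.tendsto_sqrt_atTop.comp ?_)
  exact (tendsto_atTop_add_const_right _ 1 tendsto_natCast_atTop_atTop).const_mul_atTop
    Real.two_pi_pos

theorem enorm_coeff_dirichlet_le (j : ℕ) (n : ℤ) :
    ‖coeff (dirichlet j) n‖ₑ ≤ ENNReal.ofReal (√(2 * π * (j + 1)))⁻¹ := by
  rw [dirichlet, coeff_trigPoly_of_support (fun n hn => if_neg hn)]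
  dsimp only
  split_ifs
  · rw [← ofReal_norm, Complex.norm_real, Real.norm_of_nonneg (by positivity)]
  · simp

theorem tendsto_ofReal_dirichlet_height :
    Tendsto (fun j : ℕ => ENNReal.ofReal (√(2 * π * (j + 1)))⁻¹) atTop (𝓝 0) := by
  simpa using ENNReal.tendsto_ofReal tendsto_dirichlet_height

theorem tendsto_W_dirichlet {B : ℝ} (hB : 0 < B) :
    Tendsto (fun j => W B (dirichlet j)) atTop (𝓝 (ENNReal.ofReal (B / π))) :=
  tendsto_W_of_vanishing hB norm_dirichlet_sq tendsto_ofReal_dirichlet_height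
    enorm_coeff_dirichlet_le

theorem fourierVanishing_dirichlet : FourierVanishing dirichlet := by
  intro r
  have h := ENNReal.Tendsto.const_mul (a := ((2 * r + 1 : ℕ) : ℝ≥0∞))
    (ENNReal.Tendsto.pow (n := 2) tendsto_ofReal_dirichlet_height)
    (Or.inr (ENNReal.natCast_ne_top _))
  simp only [ne_eq, OfNat.ofNat_ne_zero, not_false_eq_true, zero_pow, mul_zero] at h
  refine tendsto_of_tendsto_of_tendsto_of_le_of_le tendsto_const_nhds h (fun _ => zero_le)
    fun j => iSup_le fun m => ?_
  refine (Finset.sum_le_card_nsmul _ _ (ENNReal.ofReal (√(2 * π * (j + 1)))⁻¹ ^ 2)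
    fun n _ => ?_).trans (le_of_eq ?_)
  · gcongr
    exact enorm_coeff_dirichlet_le j n
  · rw [Int.card_Icc, nsmul_eq_mul]
    congr 2
    omega

/-- The Dirichlet kernels concentrate at the origin. -/
theorem ae_tendsto_dirichlet :
    ∀ᵐ x : Torus, Tendsto (fun j => dirichlet j x) atTop (𝓝 0) := by
  have h1 : ∀ᵐ x : Torus, ∀ j, dirichlet j x =
      (((√(2 * π * (j + 1)))⁻¹ : ℝ) : ℂ) * ∑ k ∈ Finset.range (j + 1), (fourier 1 x : ℂ) ^ k := by
    refine ae_all_iff.2 fun j => ?_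
    filter_upwards [coeFn_trigPoly ((Finset.range (j + 1)).map Nat.castEmbedding)
      fun n => if n ∈ (Finset.range (j + 1)).map (Nat.castEmbedding (R := ℤ)) then
      (((√(2 * π * (j + 1)))⁻¹ : ℝ) : ℂ) else 0] with x hx
    rw [dirichlet, hx, Finset.sum_map, Finset.mul_sum]
    refine Finset.sum_congr rfl fun k hk => ?_
    rw [if_pos (Finset.mem_map_of_mem _ hk)]
    congr 1
    simp [AddCircle.toCircle_nsmul]
  have h0 : ∀ᵐ x : Torus, x ≠ 0 := by
    have : (volume : Measure Torus) {0} = 0 := by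
      have := AddCircle.volume_closedBall (T := 2 * π) (x := 0) 0
      simpa [Real.pi_pos.le] using this
    exact compl_mem_ae_iff.2 this
  filter_upwards [h1, h0] with x hx hx0
  have hz : (fourier 1 x : ℂ) ≠ 1 := fun h => hx0 <| by
    rw [fourier_one] at h
    refine AddCircle.injective_toCircle Real.two_pi_pos.ne' ?_
    rw [AddCircle.toCircle_zero]
    exact Subtype.ext h
  have hn : ‖(fourier 1 x : ℂ)‖ = 1 := Circle.norm_coe _
  refine squeeze_zero_norm (a := fun j : ℕ => (√(2 * π * (j + 1)))⁻¹ * (2 / ‖(fourier 1 x : ℂ) - 1‖))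
    (fun j => ?_) (by simpa using tendsto_dirichlet_height.mul_const _)
  rw [hx, norm_mul, Complex.norm_real, Real.norm_of_nonneg (by positivity), geom_sum_eq hz, norm_div]
  gcongr
  refine (norm_sub_le _ _).trans ?_
  rw [norm_pow, hn]
  norm_num

theorem ae_norm_modulate (θ : ℝ) (u : L2T) : ∀ᵐ x : Torus, ‖modulate θ u x‖ = ‖u x‖ := by
  filter_upwards [MemLp.coeFn_toLp (memLp_modulate θ u)] with x hx
  have h : Complex.I * (θ : ℂ) * (angle x : ℂ) = ((θ * angle x : ℝ) : ℂ) * Complex.I := by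
    push_cast; ring
  rw [modulate, hx, norm_mul, h, Complex.norm_exp_ofReal_mul_I, one_mul]

/-- Multiplication by unimodular functions cannot restore the compactness of a normalized sequence
that tends to zero almost everywhere. -/
theorem not_tendsto_modulate {u : ℕ → L2T} (hu : ∀ j, ‖u j‖ ^ 2 = 1)
    (h0 : ∀ᵐ x : Torus, Tendsto (fun j => u j x) atTop (𝓝 0)) {φ : ℕ → ℕ} (hφ : StrictMono φ)
    (θ : ℕ → ℝ) (v : L2T) : ¬ Tendsto (fun k => modulate (θ k) (u (φ k))) atTop (𝓝 v) := by
  intro hv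
  obtain ⟨ψ, hψ, hae⟩ := (tendstoInMeasure_of_tendsto_Lp hv).exists_seq_tendsto_ae
  have hv0 : v = 0 := by
    refine (Lp.eq_zero_iff_ae_eq_zero).2 ?_
    filter_upwards [hae, h0, ae_all_iff.2 fun k => ae_norm_modulate (θ k) (u (φ k))]
      with x hx hx0 hxm
    have h1 := hx.norm
    simp only [hxm] at h1
    have h2 := (hx0.comp (hφ.tendsto_atTop.comp hψ.tendsto_atTop)).norm
    rw [norm_zero] at h2
    exact norm_eq_zero.1 (tendsto_nhds_unique h1 h2)
  have h1 : Tendsto (fun k => ‖modulate (θ k) (u (φ k))‖ ^ 2) atTop (𝓝 (‖v‖ ^ 2)) := hv.norm.pow 2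
  simp only [norm_modulate, hu, hv0, norm_zero] at h1
  simpa using tendsto_nhds_unique h1 tendsto_const_nhds

/-! ### Compactness of maximizing sequences -/

/-- Every element of `L²(𝕋)` has an integer modulation whose Fourier coefficients are, up to the
factor `2`, largest at the frequency `0`. -/
theorem exists_modulate_coeff_le (u : L2T) :
    ∃ m : ℤ, ∀ n, ‖coeff (modulate (m : ℝ) u) n‖ ≤ 2 * ‖coeff (modulate (m : ℝ) u) 0‖ := by
  have hbdd : BddAbove (Set.range fun n => ‖coeff u n‖) := by
    have h := (hasSum_norm_sq_coeff u).summable.tendsto_cofinite_zero.sqrt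
    simp only [Real.sqrt_sq (norm_nonneg _)] at h
    exact h.bddAbove_range_of_cofinite
  have hle : ∀ n, ‖coeff u n‖ ≤ ⨆ k, ‖coeff u k‖ := le_ciSup hbdd
  obtain ⟨k, hk⟩ : ∃ k, (⨆ k, ‖coeff u k‖) ≤ 2 * ‖coeff u k‖ := by
    rcases (Real.iSup_nonneg fun k => norm_nonneg (coeff u k)).eq_or_lt with h | h
    · exact ⟨0, by rw [← h]; positivity⟩
    · obtain ⟨k, hk⟩ := exists_lt_of_lt_ciSup (half_lt_self h)
      exact ⟨k, by linarith⟩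
  refine ⟨-k, fun n => ?_⟩
  rw [coeff_modulate, coeff_modulate, zero_sub, neg_neg]
  exact (hle _).trans hk

/-- Bounded sequences in `L²(𝕋)` have subsequences whose Fourier coefficients converge pointwise
to those of an element of `L²(𝕋)`. -/
theorem exists_subseq_tendsto_coeff {v : ℕ → L2T} (hv : ∀ j, ‖v j‖ ^ 2 = 1) :
    ∃ φ : ℕ → ℕ, StrictMono φ ∧ ∃ u : L2T, ∀ n,
      Tendsto (fun k => coeff (v (φ k)) n) atTop (𝓝 (coeff u n)) := by
  have hS : ∀ j, ∑' n, ‖coeff (v j) n‖ₑ ^ 2 = ENNReal.ofReal (1 / (2 * π)) := fun j => by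
    rw [tsum_enorm_sq_coeff, hv]
  have hmem : ∀ j, coeff (v j) ∈ Set.univ.pi fun _ : ℤ => Metric.closedBall (0 : ℂ) 1 := by
    intro j n _
    have h1 : ‖coeff (v j) n‖ ^ 2 ≤ 1 / (2 * π) := by
      rw [← hv j]
      exact le_hasSum (hasSum_norm_sq_coeff (v j)) n fun _ _ => by positivity
    have h2 : 1 / (2 * π) ≤ 1 := by
      rw [div_le_one Real.two_pi_pos]
      linarith [Real.pi_gt_three]
    rw [mem_closedBall_zero_iff]
    exact (sq_le_one_iff₀ (norm_nonneg _)).1 (h1.trans h2)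
  obtain ⟨α, -, φ, hφ, hα⟩ := (isCompact_univ_pi fun _ : ℤ =>
    isCompact_closedBall (0 : ℂ) 1).tendsto_subseq hmem
  rw [tendsto_pi_nhds] at hα
  have hfin : ∑' n, ‖α n‖ₑ ^ 2 ≤ ENNReal.ofReal (1 / (2 * π)) := by
    rw [ENNReal.tsum_eq_iSup_sum]
    refine iSup_le fun F => ?_
    have hlim : Tendsto (fun k => ∑ n ∈ F, ‖coeff (v (φ k)) n‖ₑ ^ 2) atTop
        (𝓝 (∑ n ∈ F, ‖α n‖ₑ ^ 2)) :=
      tendsto_finsetSum _ fun n _ => ENNReal.Tendsto.pow (hα n).enorm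
    exact le_of_tendsto' hlim fun k => (ENNReal.sum_le_tsum F).trans (hS (φ k)).le
  obtain ⟨u, hu⟩ := exists_coeff_eq (ne_top_of_le_ne_top ENNReal.ofReal_ne_top hfin)
  exact ⟨φ, hφ, u, fun n => by rw [hu]; exact hα n⟩

/-- The Pythagorean splitting of the mass along a weakly null sequence. -/
theorem tendsto_norm_add_sq {u : L2T} {r : ℕ → L2T} {M : ℝ} (hr : ∀ j, ‖r j‖ ^ 2 ≤ M)
    (h0 : ∀ n, Tendsto (fun j => coeff (r j) n) atTop (𝓝 0)) :
    Tendsto (fun j => ‖u + r j‖ ^ 2 - ‖u‖ ^ 2 - ‖r j‖ ^ 2) atTop (𝓝 0) := by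
  have hpair := tendsto_tsum_mul_of_pointwise (l := atTop) (a := fun n => ‖coeff u n‖ₑ)
    (tsum_enorm_sq_coeff_ne_top u) (r := fun j n => ‖coeff (r j) n‖ₑ)
    (M := ENNReal.ofReal (M / (2 * π))) ENNReal.ofReal_ne_top
    (fun j => by
      rw [tsum_enorm_sq_coeff]
      exact ENNReal.ofReal_le_ofReal (div_le_div_of_nonneg_right (hr j) Real.two_pi_pos.le))
    (fun n => tendsto_zero_iff_enorm_tendsto_zero.1 (h0 n))
  have hsum : ∀ j, HasSum
      (fun n => ‖coeff (u + r j) n‖ ^ 2 - ‖coeff u n‖ ^ 2 - ‖coeff (r j) n‖ ^ 2)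
      ((‖u + r j‖ ^ 2 - ‖u‖ ^ 2 - ‖r j‖ ^ 2) / (2 * π)) := fun j => by
    rw [sub_div, sub_div]
    exact ((hasSum_norm_sq_coeff _).sub (hasSum_norm_sq_coeff _)).sub (hasSum_norm_sq_coeff _)
  have hterm : ∀ x y : ℂ, ‖‖x + y‖ ^ 2 - ‖x‖ ^ 2 - ‖y‖ ^ 2‖ₑ ≤ 2 * (‖x‖ₑ * ‖y‖ₑ) := by
    intro x y
    have h : ‖‖x + y‖ ^ 2 - ‖x‖ ^ 2 - ‖y‖ ^ 2‖ ≤ 2 * (‖x‖ * ‖y‖) := by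
      have h1 := norm_add_sq_real x y
      have h2 := abs_real_inner_le_norm x y
      rw [h1, Real.norm_eq_abs, show ‖x‖ ^ 2 + 2 * inner ℝ x y + ‖y‖ ^ 2 - ‖x‖ ^ 2 - ‖y‖ ^ 2 =
        2 * inner ℝ x y by ring, abs_mul, abs_two]
      gcongr
    have h3 := ENNReal.ofReal_le_ofReal h
    rwa [ofReal_norm, ENNReal.ofReal_mul zero_le_two, ENNReal.ofReal_mul (norm_nonneg _),
      ofReal_norm, ofReal_norm, ENNReal.ofReal_ofNat] at h3
  have hlim : Tendsto (fun j => (‖u + r j‖ ^ 2 - ‖u‖ ^ 2 - ‖r j‖ ^ 2) / (2 * π)) atTop (𝓝 0) := by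
    rw [tendsto_zero_iff_enorm_tendsto_zero]
    have h2 := ENNReal.Tendsto.const_mul (a := 2) hpair (Or.inr (by finiteness))
    rw [mul_zero] at h2
    refine tendsto_of_tendsto_of_tendsto_of_le_of_le tendsto_const_nhds h2 (fun _ => zero_le)
      fun j => ?_
    rw [← (hsum j).tsum_eq]
    refine enorm_tsum_le_tsum_enorm.trans ?_
    rw [← ENNReal.tsum_mul_left]
    refine ENNReal.tsum_le_tsum fun n => ?_
    rw [coeff_add]
    exact hterm _ _
  have := hlim.mul_const (2 * π)
  rw [zero_mul] at this
  exact this.congr fun j => div_mul_cancel₀ _ Real.two_pi_pos.ne'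

/-- Precompactness of maximizing sequences modulo integer modulations, above the
threshold `B / π`. With `D = J_{B,1} - B/π > 0` and with `m` the mass of the weak limit, decoupling
gives `D ≤ D (m² + (1 - m)²)`, so that `m` is `0` or `1`; vanishing excludes `m = 0`. -/
theorem exists_modulate_tendsto_maximizer {B : ℝ} (hB : 0 < B)
    (hJ : ENNReal.ofReal (B / π) < J B 1) {u : ℕ → L2T} (hu : IsMaximizingSeq B 1 u) :
    ∃ φ : ℕ → ℕ, StrictMono φ ∧ ∃ θ : ℕ → ℤ, ∃ u₀ : L2T, IsMaximizer B 1 u₀ ∧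
      Tendsto (fun k => modulate (θ k : ℝ) (u (φ k))) atTop (𝓝 u₀) := by
  obtain ⟨hu1, huJ⟩ := hu
  have hJt := (J_one_lt_top hB).ne
  set D : ℝ := (J B 1).toReal - B / π with hD
  have hDpos : 0 < D := by
    rw [hD, sub_pos]
    exact (ENNReal.ofReal_lt_iff_lt_toReal (by positivity) hJt).1 hJ
  choose m hm using fun j => exists_modulate_coeff_le (u j)
  set v : ℕ → L2T := fun j => modulate (m j : ℝ) (u j) with hv
  have hv1 : ∀ j, ‖v j‖ ^ 2 = 1 := fun j => by rw [hv, norm_modulate, hu1]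
  have hvW : Tendsto (fun j => W B (v j)) atTop (𝓝 (J B 1)) := by
    simpa only [hv, W_modulate hB] using huJ
  have hvD : Tendsto (fun j => (rem B (coeff (v j))).re) atTop (𝓝 D) := by
    refine (((ENNReal.tendsto_toReal hJt).comp hvW).sub_const (B / π)).congr fun j => ?_
    rw [re_rem hB, show ‖v j‖ ^ 4 = (‖v j‖ ^ 2) ^ 2 by ring, hv1]
    simp
  obtain ⟨φ, hφ, u₀, hα⟩ := exists_subseq_tendsto_coeff hv1
  have hφt := hφ.tendsto_atTop
  set r : ℕ → L2T := fun k => v (φ k) - u₀ with hr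
  have hvr : ∀ k, u₀ + r k = v (φ k) := fun k => add_sub_cancel _ _
  have hr0 : ∀ n, Tendsto (fun k => coeff (r k) n) atTop (𝓝 0) := fun n => by
    simp only [hr, coeff_sub]
    simpa using (hα n).sub_const (coeff u₀ n)
  have hrb : ∀ k, ‖r k‖ ^ 2 ≤ (1 + ‖u₀‖) ^ 2 := fun k => by
    have h1 : ‖v (φ k)‖ = 1 :=
      (pow_eq_one_iff_of_nonneg (norm_nonneg _) two_ne_zero).1 (hv1 (φ k))
    have h2 : ‖r k‖ ≤ 1 + ‖u₀‖ := (norm_sub_le _ _).trans (by rw [h1])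
    gcongr
  -- The mass of the remainder converges to `1 - ‖u₀‖²`.
  have hmass : Tendsto (fun k => ‖r k‖ ^ 2) atTop (𝓝 (1 - ‖u₀‖ ^ 2)) := by
    have h := (tendsto_norm_add_sq (u := u₀) hrb hr0).const_sub (1 - ‖u₀‖ ^ 2)
    rw [sub_zero] at h
    refine h.congr fun k => ?_
    rw [hvr, hv1]
    ring
  have hm1 : ‖u₀‖ ^ 2 ≤ 1 := by
    have := ge_of_tendsto' hmass fun k => by positivity
    linarith
  have hdec := tendsto_rem_add_sub (l := atTop) hB (tsum_enorm_sq_coeff_ne_top u₀)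
    (r := fun k => coeff (r k)) (M := ENNReal.ofReal ((1 + ‖u₀‖) ^ 2 / (2 * π)))
    ENNReal.ofReal_ne_top
    (fun k => by
      rw [tsum_enorm_sq_coeff]
      exact ENNReal.ofReal_le_ofReal (div_le_div_of_nonneg_right (hrb k) Real.two_pi_pos.le)) hr0
  have hcoe : ∀ k, coeff u₀ + coeff (r k) = coeff (v (φ k)) := fun k => funext fun n => by
    rw [← hvr, coeff_add, Pi.add_apply]
  simp only [hcoe] at hdec
  have hineq : D ≤ D * (‖u₀‖ ^ 2) ^ 2 + D * (1 - ‖u₀‖ ^ 2) ^ 2 := by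
    have h1 := ((hvD.comp hφt).sub ((Complex.continuous_re.tendsto _).comp hdec))
    rw [Complex.zero_re, sub_zero] at h1
    have h2 : Tendsto (fun k => D * (‖u₀‖ ^ 2) ^ 2 + D * (‖r k‖ ^ 2) ^ 2) atTop
        (𝓝 (D * (‖u₀‖ ^ 2) ^ 2 + D * (1 - ‖u₀‖ ^ 2) ^ 2)) :=
      ((hmass.pow 2).const_mul D).const_add _
    refine le_of_tendsto_of_tendsto' h1 h2 fun k => ?_
    have h3 := re_rem_le hB u₀
    have h4 := re_rem_le hB (r k)
    simp only [Function.comp_apply, Complex.sub_re]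
    rw [show (‖u₀‖ ^ 2) ^ 2 = ‖u₀‖ ^ 4 by ring, show (‖r k‖ ^ 2) ^ 2 = ‖r k‖ ^ 4 by ring]
    linarith
  have hne : ‖u₀‖ ^ 2 ≠ 0 := by
    intro h0
    have hu0 : coeff u₀ 0 = 0 := by
      have h := hasSum_norm_sq_coeff u₀
      rw [h0, zero_div] at h
      have := (hasSum_zero_iff_of_nonneg fun n => by positivity).1 h
      simpa using congrFun this 0
    have hs : Tendsto (fun k => ENNReal.ofReal (2 * ‖coeff (v (φ k)) 0‖)) atTop (𝓝 0) := by
      have h := ((hα 0).norm.const_mul 2)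
      rw [hu0, norm_zero, mul_zero] at h
      simpa using ENNReal.tendsto_ofReal h
    have hW0 := tendsto_W_of_vanishing hB (fun k => hv1 (φ k)) hs fun k n => by
      rw [← ofReal_norm]
      exact ENNReal.ofReal_le_ofReal (hm (φ k) n)
    exact hJ.ne (tendsto_nhds_unique hW0 (hvW.comp hφt))
  have hone : ‖u₀‖ ^ 2 = 1 := by
    have h1 : 0 < ‖u₀‖ ^ 2 := lt_of_le_of_ne (by positivity) hne.symm
    have h2 : 0 ≤ D * (‖u₀‖ ^ 2 * (‖u₀‖ ^ 2 - 1)) := by nlinarith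
    have h3 := nonneg_of_mul_nonneg_right h2 hDpos
    have h4 := nonneg_of_mul_nonneg_right h3 h1
    linarith
  have hconv : Tendsto (fun k => v (φ k)) atTop (𝓝 u₀) := by
    rw [hone, sub_self] at hmass
    rw [tendsto_iff_norm_sub_tendsto_zero]
    simpa using hmass.sqrt
  exact ⟨φ, hφ, fun k => m (φ k), u₀,
    ⟨hone, tendsto_nhds_unique (tendsto_W hB hconv) (hvW.comp hφt)⟩, hconv⟩

theorem exists_isMaximizingSeq (B : ℝ) : ∃ u, IsMaximizingSeq B 1 u := by
  have hJ : J B 1 = sSup (W B '' {u : L2T | ‖u‖ ^ 2 = 1}) := by rw [sSup_image]; rfl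
  obtain ⟨w, -, hw, hmem⟩ := exists_seq_tendsto_sSup
    (S := W B '' {u : L2T | ‖u‖ ^ 2 = 1}) ⟨_, dirichlet 0, norm_dirichlet_sq 0, rfl⟩
    (OrderTop.bddAbove _)
  choose u hu1 huW using hmem
  refine ⟨u, hu1, ?_⟩
  rw [hJ]
  exact hw.congr fun j => (huW j).symm

end TorusStrichartz

theorem theorem1 (B : ℝ) (hB : 0 < B) :
    -- `J_{B,1}` is a real number
    TorusStrichartz.J B 1 < ∞ ∧
    -- (i)
    (ENNReal.ofReal (B / π) < TorusStrichartz.J B 1 →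
      (∀ u : ℕ → TorusStrichartz.L2T, TorusStrichartz.IsMaximizingSeq B 1 u →
        ∃ φ : ℕ → ℕ, StrictMono φ ∧ ∃ θ : ℕ → ℤ, ∃ u₀ : TorusStrichartz.L2T,
          TorusStrichartz.IsMaximizer B 1 u₀ ∧
          Tendsto (fun k => TorusStrichartz.modulate (θ k : ℝ) (u (φ k))) atTop (𝓝 u₀)) ∧
      ∃ u₀ : TorusStrichartz.L2T, TorusStrichartz.IsMaximizer B 1 u₀) ∧
    -- (ii)
    ENNReal.ofReal (B / π) ≤ TorusStrichartz.J B 1 ∧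
    -- (iii)
    (TorusStrichartz.J B 1 = ENNReal.ofReal (B / π) →
      ∃ u : ℕ → TorusStrichartz.L2T, TorusStrichartz.IsMaximizingSeq B 1 u ∧
        TorusStrichartz.FourierVanishing u ∧
        ∀ φ : ℕ → ℕ, StrictMono φ → ∀ θ : ℕ → ℝ, ¬ ∃ v : TorusStrichartz.L2T,
          Tendsto (fun k => TorusStrichartz.modulate (θ k) (u (φ k))) atTop (𝓝 v)) := by
  open TorusStrichartz in
  have hge : ENNReal.ofReal (B / π) ≤ J B 1 :=
    le_of_tendsto' (tendsto_W_dirichlet hB) fun j => W_le_J B (norm_dirichlet_sq j)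
  open TorusStrichartz in
  refine ⟨J_one_lt_top hB, fun hJ => ⟨fun u hu => exists_modulate_tendsto_maximizer hB hJ hu, ?_⟩,
    hge, fun hJ => ⟨dirichlet, ⟨norm_dirichlet_sq, ?_⟩, fourierVanishing_dirichlet, ?_⟩⟩
  · obtain ⟨u, hu⟩ := TorusStrichartz.exists_isMaximizingSeq B
    obtain ⟨_, _, _, u₀, hu₀, _⟩ :=
      TorusStrichartz.exists_modulate_tendsto_maximizer hB hJ hu
    exact ⟨u₀, hu₀⟩
  · rw [hJ]
    exact TorusStrichartz.tendsto_W_dirichlet hB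
  · rintro φ hφ θ ⟨v, hv⟩
    exact TorusStrichartz.not_tendsto_modulate TorusStrichartz.norm_dirichlet_sq
      TorusStrichartz.ae_tendsto_dirichlet hφ θ v hv
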